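/- Let $n\ge 0$ be an integer, $u\in\mathbb C\setminus\{0\}$ and $\alpha\in\mathbb C$. All algebras are associative unital $\mathbb C$-algebras. The spin symmetric group algebra $\mathbb C S_n^-$ is generated by $t_1,\dots,t_{n-1}$ subject to $$t_i^2=1,\qquad t_it_{i+1}t_i=t_{i+1}t_it_{i+1},\qquad t_it_j=-t_jt_i\quad(|i-j|>1). \tag{1}$$ For $1\le i<j\le n$ put $[i,j]=-[j,i]=(-1)^{j-i-1}t_{j-1}\cdots t_{i+1}t_it_{i+1}\cdots t_{j-1}$, and for $1\le j\le n$ put $\mathtt M_j=\sum_{k<j}[k,j]$ (the odd Jucys–Murphy elements). The rational spin double affine Hecke algebra $\ddot{\mathfrak H}^-$ with parameter $u$ is generated by $\xi_i,y_i$ $(1\le i\le n)$ and $t_i$ $(1\le i\le n-1)$ subject to (1) and $$\xi_i\xi_j=-\xi_j\xi_i,\quad y_iy_j=y_jy_i\quad(i\ne j),\qquad t_i\xi_i=-\xi_{i+1}t_i,\quad t_iy_i=y_{i+1}t_i,$$ $$t_j\xi_i=-\xi_it_j,\quad t_jy_i=y_it_j\quad(i\ne j,j+1),$$ $$y_i\xi_j-\xi_jy_i=u[i,j]\quad(i\ne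 j),\qquad y_i\xi_i-\xi_iy_i=u\sum_{k\ne i}[i,k].$$ The degenerate spin affine Hecke algebra $\mathfrak H^-$ is generated by $b_i$ $(1\le i\le n)$ and $t_i$ $(1\le i\le n-1)$ subject to (1) and $$b_ib_j=-b_jb_i\quad(i\neq j),\qquad b_{i+1}t_i=-t_ib_i+1,\qquad t_jb_i=-b_it_j\quad(i\ne j,j+1).$$ In $\ddot{\mathfrak H}^-$ set $\mathfrak z_i=u^{-1}y_i\xi_i+\mathtt M_i$. **Theorem.** The subalgebra of $\ddot{\mathfrak H}^-$ generated by (the image of) $\mathbb C S_n^-$ and the elements $\alpha\xi_i+\mathfrak z_i$ $(1\le i\le n)$ is isomorphic to $\mathfrak H^-$. More precisely, there is an algebra isomorphism from $\mathfrak H^-$ onto this subalgebra with $b_i\mapsto\alpha\xi_i+\mathfrak z_i$ $(1\le i\le n)$ and $t_i\mapsto t_i$ $(1\le i\le n-1)$. -/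

import Mathlib

noncomputable section

namespace SpinHecke

/-- The first of the two positions moved by the `i`-th simple transposition
(all indices are counted from `0`). -/
def lo {n : ℕ} (i : Fin (n - 1)) : Fin n := ⟨i.1, by omega⟩

/-- The second of the two positions moved by the `i`-th simple transposition. -/
def hi {n : ℕ} (i : Fin (n - 1)) : Fin n := ⟨i.1 + 1, by omega⟩

/-- The defining relations of the spin symmetric group algebra, for a family `t` in a ring. -/
inductive SpinRel {n : ℕ} {A : Type*} [Ring A] (t : Fin (n - 1) → A) : A → A → Prop
  | sq (i : Fin (n - 1)) : SpinRel t (t i * t i) 1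
  | braid (i j : Fin (n - 1)) (h : i.1 + 1 = j.1) :
      SpinRel t (t i * t j * t i) (t j * t i * t j)
  | anticomm (i j : Fin (n - 1)) (h : i.1 + 1 < j.1 ∨ j.1 + 1 < i.1) :
      SpinRel t (t i * t j) (-(t j * t i))

/-- The family `t`, re-indexed by natural numbers (and `0` outside of its range). -/
def ext {n : ℕ} {A : Type*} [Ring A] (t : Fin (n - 1) → A) (k : ℕ) : A :=
  if h : k < n - 1 then t ⟨k, h⟩ else 0

/-- For `i < j`, the product
`(-1)^(j-i-1) t_{j-1} ⋯ t_{i+1} t_i t_{i+1} ⋯ t_{j-1}`. -/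
def oddTransAux {n : ℕ} {A : Type*} [Ring A] (t : Fin (n - 1) → A) (i j : ℕ) : A :=
  (-1) ^ (j - i - 1) * ((List.range' (i + 1) (j - i - 1)).reverse.map (ext t)).prod
    * ext t i * ((List.range' (i + 1) (j - i - 1)).map (ext t)).prod

/-- The odd transposition `[i,j]`, with `[j,i] = -[i,j]`; the value for `i = j`, which is not
used anywhere, is `0`. -/
def oddTrans {n : ℕ} {A : Type*} [Ring A] (t : Fin (n - 1) → A) (i j : Fin n) : A :=
  if i < j then oddTransAux t i.1 j.1
  else if j < i then -oddTransAux t j.1 i.1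
  else 0

/-- The odd Jucys–Murphy element `M_j = ∑_{k < j} [k,j]`. -/
def oddJM {n : ℕ} {A : Type*} [Ring A] (t : Fin (n - 1) → A) (j : Fin n) : A :=
  ∑ k ∈ Finset.univ.filter (fun k : Fin n => k < j), oddTrans t k j

/-! ### The spin symmetric group algebra -/

/-- The spin symmetric group algebra `ℂS_n^-`. -/
abbrev SpinSym (n : ℕ) : Type :=
  RingQuot (SpinRel (n := n) (FreeAlgebra.ι ℂ : Fin (n - 1) → FreeAlgebra ℂ (Fin (n - 1))))

/-- The generators `t_i` of the spin symmetric group algebra. -/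
def SpinSym.t {n : ℕ} (i : Fin (n - 1)) : SpinSym n :=
  RingQuot.mkAlgHom ℂ _ (FreeAlgebra.ι ℂ i)

/-! ### The rational spin double affine Hecke algebra -/

/-- The generators of the rational spin double affine Hecke algebra. -/
inductive DGen (n : ℕ) : Type
  | xi (i : Fin n) : DGen n
  | y (i : Fin n) : DGen n
  | t (i : Fin (n - 1)) : DGen n

/-- The free generators `ξ_i`. -/
def fxi {n : ℕ} (i : Fin n) : FreeAlgebra ℂ (DGen n) := FreeAlgebra.ι ℂ (DGen.xi i)

/-- The free generators `y_i`. -/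
def fy {n : ℕ} (i : Fin n) : FreeAlgebra ℂ (DGen n) := FreeAlgebra.ι ℂ (DGen.y i)

/-- The free generators `t_i`. -/
def ft {n : ℕ} (i : Fin (n - 1)) : FreeAlgebra ℂ (DGen n) := FreeAlgebra.ι ℂ (DGen.t i)

/-- The defining relations of the rational spin double affine Hecke algebra. -/
inductive DRel (u : ℂ) (n : ℕ) : FreeAlgebra ℂ (DGen n) → FreeAlgebra ℂ (DGen n) → Prop
  | spin (a b : FreeAlgebra ℂ (DGen n)) (h : SpinRel ft a b) : DRel u n a b
  | xi_xi (i j : Fin n) (h : i ≠ j) : DRel u n (fxi i * fxi j) (-(fxi j * fxi i))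
  | y_y (i j : Fin n) (h : i ≠ j) : DRel u n (fy i * fy j) (fy j * fy i)
  | t_xi (i : Fin (n - 1)) : DRel u n (ft i * fxi (lo i)) (-(fxi (hi i) * ft i))
  | t_y (i : Fin (n - 1)) : DRel u n (ft i * fy (lo i)) (fy (hi i) * ft i)
  | t_xi_far (j : Fin (n - 1)) (i : Fin n) (h : i ≠ lo j) (h' : i ≠ hi j) :
      DRel u n (ft j * fxi i) (-(fxi i * ft j))
  | t_y_far (j : Fin (n - 1)) (i : Fin n) (h : i ≠ lo j) (h' : i ≠ hi j) :
      DRel u n (ft j * fy i) (fy i * ft j)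
  | y_xi (i j : Fin n) (h : i ≠ j) :
      DRel u n (fy i * fxi j - fxi j * fy i) (u • oddTrans ft i j)
  | y_xi_self (i : Fin n) :
      DRel u n (fy i * fxi i - fxi i * fy i)
        (u • ∑ k ∈ Finset.univ.filter (fun k : Fin n => k ≠ i), oddTrans ft i k)

/-- The rational spin double affine Hecke algebra with parameter `u`. -/
abbrev SpinDaha (u : ℂ) (n : ℕ) : Type := RingQuot (DRel u n)

/-- The generators `ξ_i` of the rational spin double affine Hecke algebra. -/
def SpinDaha.xi (u : ℂ) {n : ℕ} (i : Fin n) : SpinDaha u n :=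
  RingQuot.mkAlgHom ℂ (DRel u n) (fxi i)

/-- The generators `y_i` of the rational spin double affine Hecke algebra. -/
def SpinDaha.y (u : ℂ) {n : ℕ} (i : Fin n) : SpinDaha u n :=
  RingQuot.mkAlgHom ℂ (DRel u n) (fy i)

/-- The generators `t_i` of the rational spin double affine Hecke algebra. -/
def SpinDaha.t (u : ℂ) {n : ℕ} (i : Fin (n - 1)) : SpinDaha u n :=
  RingQuot.mkAlgHom ℂ (DRel u n) (ft i)

/-- The canonical homomorphism from the spin symmetric group algebra to the rational spin double
affine Hecke algebra, with `t_i ↦ t_i`. -/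
def SpinDaha.ofSpinSym (u : ℂ) (n : ℕ) : SpinSym n →ₐ[ℂ] SpinDaha u n :=
  RingQuot.liftAlgHom ℂ ⟨FreeAlgebra.lift ℂ (SpinDaha.t u), by
    have key : ∀ a b : FreeAlgebra ℂ (DGen n), SpinRel ft a b →
        RingQuot.mkAlgHom ℂ (DRel u n) a = RingQuot.mkAlgHom ℂ (DRel u n) b :=
      fun a b h => RingQuot.mkAlgHom_rel ℂ (DRel.spin a b h)
    intro a b h
    cases h with
    | sq i => simpa [SpinDaha.t] using key _ _ (SpinRel.sq i)
    | braid i j h => simpa [SpinDaha.t] using key _ _ (SpinRel.braid i j h)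
    | anticomm i j h => simpa [SpinDaha.t] using key _ _ (SpinRel.anticomm i j h)⟩

theorem SpinDaha.ofSpinSym_t (u : ℂ) {n : ℕ} (i : Fin (n - 1)) :
    SpinDaha.ofSpinSym u n (SpinSym.t i) = SpinDaha.t u i := by
  simp [SpinDaha.ofSpinSym, SpinSym.t]

/-- The elements `𝔷_i = u⁻¹ y_i ξ_i + M_i`. -/
def SpinDaha.z (u : ℂ) {n : ℕ} (i : Fin n) : SpinDaha u n :=
  u⁻¹ • (SpinDaha.y u i * SpinDaha.xi u i) + SpinDaha.ofSpinSym u n (oddJM SpinSym.t i)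

/-- The subalgebra generated by `α ξ_i + 𝔷_i` for all `i` and (the image of) the spin symmetric
group algebra. -/
def SpinDaha.affineSubalgebra (u α : ℂ) (n : ℕ) : Subalgebra ℂ (SpinDaha u n) :=
  Algebra.adjoin ℂ
    (Set.range (fun i : Fin n => α • SpinDaha.xi u i + SpinDaha.z u i) ∪
      Set.range (SpinDaha.ofSpinSym u n))

/-! ### The degenerate spin affine Hecke algebra -/

/-- The generators of the degenerate spin affine Hecke algebra. -/
inductive AGen (n : ℕ) : Type
  | b (i : Fin n) : AGen n
  | t (i : Fin (n - 1)) : AGen n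

/-- The free generators `b_i`. -/
def gb {n : ℕ} (i : Fin n) : FreeAlgebra ℂ (AGen n) := FreeAlgebra.ι ℂ (AGen.b i)

/-- The free generators `t_i`. -/
def gt {n : ℕ} (i : Fin (n - 1)) : FreeAlgebra ℂ (AGen n) := FreeAlgebra.ι ℂ (AGen.t i)

/-- The defining relations of the degenerate spin affine Hecke algebra. -/
inductive ARel (n : ℕ) : FreeAlgebra ℂ (AGen n) → FreeAlgebra ℂ (AGen n) → Prop
  | spin (p q : FreeAlgebra ℂ (AGen n)) (h : SpinRel gt p q) : ARel n p q
  | b_b (i j : Fin n) (h : i ≠ j) : ARel n (gb i * gb j) (-(gb j * gb i))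
  | b_t (i : Fin (n - 1)) : ARel n (gb (hi i) * gt i) (-(gt i * gb (lo i)) + 1)
  | t_b_far (j : Fin (n - 1)) (i : Fin n) (h : i ≠ lo j) (h' : i ≠ hi j) :
      ARel n (gt j * gb i) (-(gb i * gt j))

/-- The degenerate spin affine Hecke algebra. -/
abbrev SpinAffine (n : ℕ) : Type := RingQuot (ARel n)

/-- The generators `b_i` of the degenerate spin affine Hecke algebra. -/
def SpinAffine.b {n : ℕ} (i : Fin n) : SpinAffine n :=
  RingQuot.mkAlgHom ℂ (ARel n) (gb i)

/-- The generators `t_i` of the degenerate spin affine Hecke algebra. -/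
def SpinAffine.t {n : ℕ} (i : Fin (n - 1)) : SpinAffine n :=
  RingQuot.mkAlgHom ℂ (ARel n) (gt i)

end SpinHecke

end

/-!
The elements `b_i = α ξ_i + 𝔷_i` satisfy the relations of the affine algebra by a direct computation
(`IsDaha.isAffine`). It rests on one fact about the odd transpositions `[k,j]`: being products of an
odd number of the `t_i`, they permute the `ξ_i`, the `y_i` and each other by the transposition
`s_{kj}`, up to the same signs as the `t_i` do (`IsSpin.oddTrans_mul`). This yields a homomorphism from
the affine algebra onto the subalgebra in question, and its injectivity remains to be shown.

The affine algebra is spanned by the products of a monomial in the `b_i`, taken in one order for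
each exponent, with an element of the spin symmetric group algebra (`SpinAffine.expand_surjective`).
Their images are separated by a polynomial representation of the double affine Hecke algebra
(`isDaha_dunkl`) on `ℂ[x] ⊗ V`, where `V` is a module with operators `c_i` and `t_i` such that the
`c_i` anticommute and `t_i c_k = -c_{s_i k} t_i`: here `y_i` acts by `x_i`, `t_i` by `s_i ⊗ t_i`,
and `ξ_j` by the odd Dunkl operator `1 ⊗ c_j - u ∑_{k ≠ j} Δ_{kj} ⊗ [k,j]` with the divided
differences `Δ_{kj} = (1 - s_{kj}) / (x_k - x_j)`. Dunkl operators anticommute because of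
`Δ_{kj}² = 0` and the three-term relation `divDiff_three`.

As divided differences lower the degree in `x`, the operator `b_i` is `u⁻¹ x_i ⊗ c_i` up to
operators that do not raise the degree (`dunkl_leadingTerm`). So the image of `∑ b^m τ_m` applied to
`1 ⊗ v` has the coefficient `u^{-|m|} c^m τ_m v` at each monomial `x^m` of the highest degree. For
`V` the tensor product of a Clifford algebra and the spin symmetric group algebra, `c_i² = 1` and
the second algebra acts faithfully (`SpinSym.eq_zero_of_lift_skewT`), so that such a combination
vanishes only if all `τ_m` do.
-/

noncomputable section

namespace SpinHecke

open Equiv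

/-! ### Odd transpositions -/

section OddTrans

variable {n : ℕ} {A : Type*} [Ring A]

/-- The `i`-th simple transposition. -/
def simpleSwap (i : Fin (n - 1)) : Perm (Fin n) := swap (lo i) (hi i)

/-- A family satisfying the defining relations of the spin symmetric group algebra. -/
def IsSpin (t : Fin (n - 1) → A) : Prop := ∀ a b, SpinRel t a b → a = b

variable {t : Fin (n - 1) → A}

theorem ext_of_lt {k : ℕ} (h : k < n - 1) : ext t k = t ⟨k, h⟩ := dif_pos h

theorem IsSpin.mul_self (ht : IsSpin t) (i : Fin (n - 1)) : t i * t i = 1 := ht _ _ (.sq i)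

theorem IsSpin.ext_mul_self (ht : IsSpin t) {k : ℕ} (h : k < n - 1) :
    ext t k * ext t k = 1 := by
  rw [ext_of_lt h, ht.mul_self]

theorem IsSpin.ext_braid (ht : IsSpin t) {k : ℕ} (h : k + 1 < n - 1) :
    ext t k * ext t (k + 1) * ext t k = ext t (k + 1) * ext t k * ext t (k + 1) := by
  rw [ext_of_lt h, ext_of_lt (by omega : k < n - 1)]
  exact ht _ _ (.braid _ _ rfl)

theorem IsSpin.ext_anticomm (ht : IsSpin t) {k l : ℕ} (h : k + 1 < l ∨ l + 1 < k) :
    ext t k * ext t l = -(ext t l * ext t k) := by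
  by_cases hk : k < n - 1
  · by_cases hl : l < n - 1
    · rw [ext_of_lt hk, ext_of_lt hl]
      exact ht _ _ (.anticomm _ _ h)
    · simp [ext, hl]
  · simp [ext, hk]

theorem oddTransAux_succ_self (t : Fin (n - 1) → A) (i : ℕ) :
    oddTransAux t i (i + 1) = ext t i := by
  simp [oddTransAux]

theorem oddTransAux_succ (t : Fin (n - 1) → A) {i j : ℕ} (h : i < j) :
    oddTransAux t i (j + 1) = -(ext t j * oddTransAux t i j * ext t j) := by
  obtain ⟨d, rfl⟩ := Nat.exists_eq_add_of_lt h
  have h1 : i + d + 1 + 1 - i - 1 = d + 1 := by omega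
  have h2 : i + d + 1 - i - 1 = d := by omega
  have h3 : i + 1 + d = i + d + 1 := by omega
  simp only [oddTransAux, h1, h2, List.range'_1_concat, h3, List.reverse_append, List.map_append,
    List.prod_append, List.map_cons, List.map_nil, List.prod_cons, List.prod_nil,
    List.reverse_cons, List.reverse_nil, List.nil_append, mul_one, pow_succ]
  rcases neg_one_pow_eq_or A d with hd | hd <;> rw [hd] <;> noncomm_ring

theorem oddTransAux_anticomm {x : A} {i j : ℕ} (hij : i < j)
    (hx : ∀ k, i ≤ k → k < j → x * ext t k = -(ext t k * x)) :
    x * oddTransAux t i j = -(oddTransAux t i j * x) := by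
  induction j, hij using Nat.le_induction with
  | base => rw [oddTransAux_succ_self]; exact hx i le_rfl (Nat.lt_succ_self i)
  | succ j hj ih =>
    have h1 := ih fun k h h' => hx k h (by omega)
    have h2 := hx j (by omega) (by omega)
    rw [oddTransAux_succ t hj]
    calc x * -(ext t j * oddTransAux t i j * ext t j)
        = -(x * ext t j) * oddTransAux t i j * ext t j := by noncomm_ring
      _ = ext t j * (x * oddTransAux t i j) * ext t j := by rw [h2]; noncomm_ring
      _ = -(ext t j * oddTransAux t i j * (x * ext t j)) := by rw [h1]; noncomm_ring
      _ = _ := by rw [h2]; noncomm_ring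

/-- The odd transposition can be built up from its lower end as well as from its upper end. -/
theorem IsSpin.oddTransAux_pred (ht : IsSpin t) {i j : ℕ} (hij : i + 1 < j) (hj : j < n) :
    oddTransAux t i j = -(ext t i * oddTransAux t (i + 1) j * ext t i) := by
  induction j, hij using Nat.le_induction with
  | base =>
    rw [oddTransAux_succ t (Nat.lt_succ_self i), oddTransAux_succ_self, oddTransAux_succ_self,
      ht.ext_braid (by omega)]
  | succ j h ih =>
    have h2 : ext t j * ext t i = -(ext t i * ext t j) := ht.ext_anticomm (by omega)
    rw [oddTransAux_succ t (by omega), oddTransAux_succ t (by omega), ih (by omega)]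
    calc -(ext t j * -(ext t i * oddTransAux t (i + 1) j * ext t i) * ext t j)
        = (ext t j * ext t i) * oddTransAux t (i + 1) j * (ext t i * ext t j) := by noncomm_ring
      _ = -(ext t i * ext t j * oddTransAux t (i + 1) j * (ext t i * ext t j)) := by
        rw [h2]; noncomm_ring
      _ = ext t i * ext t j * oddTransAux t (i + 1) j * (ext t j * ext t i) := by
        rw [h2]; noncomm_ring
      _ = _ := by noncomm_ring

/-- A simple generator strictly between the two ends anticommutes with an odd transposition. -/
theorem IsSpin.oddTransAux_inner (ht : IsSpin t) {i m j : ℕ} (him : i < m) (hmj : m + 1 < j)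
    (hj : j < n) :
    ext t m * oddTransAux t i j = -(oddTransAux t i j * ext t m) := by
  induction j, hmj using Nat.le_induction with
  | base =>
    have hb := ht.ext_braid (k := m) (by omega)
    have hL : ext t (m + 1) * oddTransAux t i m = -(oddTransAux t i m * ext t (m + 1)) :=
      oddTransAux_anticomm him fun k _ _ => ht.ext_anticomm (by omega)
    rw [oddTransAux_succ t (by omega), oddTransAux_succ t him]
    set a := ext t m
    set b := ext t (m + 1)
    set L := oddTransAux t i m
    calc a * -(b * -(a * L * a) * b) = (a * b * a) * L * (a * b) := by noncomm_ring
      _ = b * a * (b * L) * (a * b) := by rw [hb]; noncomm_ring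
      _ = -(b * a * L * (b * a * b)) := by rw [hL]; noncomm_ring
      _ = _ := by rw [← hb]; noncomm_ring
  | succ j h ih =>
    have h2 : ext t m * ext t j = -(ext t j * ext t m) := ht.ext_anticomm (by omega)
    rw [oddTransAux_succ t (by omega)]
    calc ext t m * -(ext t j * oddTransAux t i j * ext t j)
        = -(ext t m * ext t j) * oddTransAux t i j * ext t j := by noncomm_ring
      _ = ext t j * (ext t m * oddTransAux t i j) * ext t j := by rw [h2]; noncomm_ring
      _ = -(ext t j * oddTransAux t i j * (ext t m * ext t j)) := by
        rw [ih (by omega)]; noncomm_ring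
      _ = _ := by rw [h2]; noncomm_ring

theorem oddTrans_of_lt (t : Fin (n - 1) → A) {a b : Fin n} (h : a < b) :
    oddTrans t a b = oddTransAux t a b := if_pos h

theorem oddTrans_self (t : Fin (n - 1) → A) (a : Fin n) : oddTrans t a a = 0 := by
  simp [oddTrans]

theorem oddTrans_comm (t : Fin (n - 1) → A) (a b : Fin n) :
    oddTrans t a b = -oddTrans t b a := by
  rcases lt_trichotomy a b with h | h | h
  · simp [oddTrans, h, h.not_gt]
  · simp [oddTrans, h]
  · simp [oddTrans, h, h.not_gt]

theorem lo_lt_hi (i : Fin (n - 1)) : lo i < hi i := Nat.lt_succ_self i.1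

theorem lo_ne_hi (i : Fin (n - 1)) : lo i ≠ hi i := (lo_lt_hi i).ne

theorem oddTrans_lo_hi (t : Fin (n - 1) → A) (i : Fin (n - 1)) :
    oddTrans t (lo i) (hi i) = t i := by
  rw [oddTrans_of_lt t (lo_lt_hi i)]
  exact (oddTransAux_succ_self t i.1).trans (ext_of_lt i.2)

theorem simpleSwap_lo (i : Fin (n - 1)) : simpleSwap i (lo i) = hi i := swap_apply_left _ _

theorem simpleSwap_hi (i : Fin (n - 1)) : simpleSwap i (hi i) = lo i := swap_apply_right _ _

theorem simpleSwap_far {i : Fin (n - 1)} {a : Fin n} (h : a ≠ lo i) (h' : a ≠ hi i) :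
    simpleSwap i a = a := swap_apply_of_ne_of_ne h h'

theorem simpleSwap_mul_self (i : Fin (n - 1)) : simpleSwap i * simpleSwap i = 1 :=
  swap_mul_self _ _

theorem IsSpin.mul_oddTrans_of_lt (ht : IsSpin t) (i : Fin (n - 1)) {a b : Fin n} (hab : a < b) :
    t i * oddTrans t a b = -(oddTrans t (simpleSwap i a) (simpleSwap i b) * t i) := by
  have hab' : a.1 < b.1 := hab
  have hi1 := i.2
  have hb := b.2
  have hti : ext t i.1 = t i := ext_of_lt i.2
  have hsq : ext t i.1 * ext t i.1 = 1 := ht.ext_mul_self i.2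
  -- `s_i` fixes a position different from `i` and `i + 1`
  have far : ∀ c : Fin n, c.1 ≠ i.1 → c.1 ≠ i.1 + 1 → simpleSwap i c = c := fun c h h' =>
    simpleSwap_far (fun e => h (congrArg Fin.val e)) (fun e => h' (congrArg Fin.val e))
  rw [oddTrans_of_lt t hab, ← hti]
  by_cases h1 : a.1 = i.1
  · obtain rfl : a = lo i := Fin.ext h1
    rw [simpleSwap_lo]
    by_cases h2 : b.1 = i.1 + 1
    · obtain rfl : b = hi i := Fin.ext h2
      rw [simpleSwap_hi, oddTrans_comm, oddTrans_lo_hi, ← hti, neg_mul, neg_neg]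
      exact congrArg _ (oddTransAux_succ_self t i.1)
    · have hlt : hi i < b := by
        change i.1 + 1 < b.1
        omega
      rw [far b (by omega) h2, oddTrans_of_lt t hlt]
      change ext t i.1 * oddTransAux t i.1 b.1 = -(oddTransAux t (i.1 + 1) b.1 * ext t i.1)
      rw [ht.oddTransAux_pred (by omega) hb, mul_neg, ← mul_assoc, ← mul_assoc, hsq, one_mul]
  by_cases h2 : a.1 = i.1 + 1
  · obtain rfl : a = hi i := Fin.ext h2
    have hlt : lo i < b := by
      change i.1 < b.1
      omega
    rw [simpleSwap_hi, far b (by omega) (by omega), oddTrans_of_lt t hlt]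
    change ext t i.1 * oddTransAux t (i.1 + 1) b.1 = -(oddTransAux t i.1 b.1 * ext t i.1)
    rw [ht.oddTransAux_pred (i := i.1) (by omega) hb, neg_mul, neg_neg, mul_assoc, hsq, mul_one]
  rw [far a h1 h2]
  by_cases h3 : b.1 = i.1
  · obtain rfl : b = lo i := Fin.ext h3
    rw [simpleSwap_lo, oddTrans_of_lt t (hab.trans (lo_lt_hi i))]
    change ext t i.1 * oddTransAux t a.1 i.1 = -(oddTransAux t a.1 (i.1 + 1) * ext t i.1)
    rw [oddTransAux_succ t (by omega), neg_mul, neg_neg, mul_assoc, hsq, mul_one]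
  by_cases h4 : b.1 = i.1 + 1
  · obtain rfl : b = hi i := Fin.ext h4
    have hlt : a < lo i := by
      change a.1 < i.1
      omega
    rw [simpleSwap_hi, oddTrans_of_lt t hlt]
    change ext t i.1 * oddTransAux t a.1 (i.1 + 1) = -(oddTransAux t a.1 i.1 * ext t i.1)
    rw [oddTransAux_succ t (show a.1 < i.1 from hlt), mul_neg, ← mul_assoc, ← mul_assoc, hsq,
      one_mul]
  rw [far b h3 h4, oddTrans_of_lt t hab]
  by_cases h5 : a.1 < i.1 ∧ i.1 < b.1
  · exact ht.oddTransAux_inner h5.1 (by omega) hb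
  · exact oddTransAux_anticomm hab' fun k _ _ => ht.ext_anticomm (by omega)

/-- Conjugation by `t_i` permutes the odd transpositions up to the sign `-1`. -/
theorem IsSpin.mul_oddTrans (ht : IsSpin t) (i : Fin (n - 1)) (a b : Fin n) :
    t i * oddTrans t a b = -(oddTrans t (simpleSwap i a) (simpleSwap i b) * t i) := by
  rcases lt_trichotomy a b with h | rfl | h
  · exact ht.mul_oddTrans_of_lt i h
  · simp [oddTrans_self]
  · rw [oddTrans_comm t a, oddTrans_comm t (simpleSwap i a), mul_neg, ht.mul_oddTrans_of_lt i h,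
      neg_mul]

theorem IsSpin.oddTrans_conj (ht : IsSpin t) (i : Fin (n - 1)) (a b : Fin n) :
    oddTrans t (simpleSwap i a) (simpleSwap i b) = -(t i * oddTrans t a b * t i) := by
  rw [ht.mul_oddTrans, neg_mul, neg_neg, mul_assoc, ht.mul_self, mul_one]

/-- Every ordered pair of distinct positions is reached from an adjacent pair by simple
transpositions. -/
theorem pair_induction {p : Fin n → Fin n → Prop} (adj : ∀ i, p (lo i) (hi i))
    (step : ∀ i a b, a ≠ b → p a b → p (simpleSwap i a) (simpleSwap i b)) :
    ∀ a b, a ≠ b → p a b := by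
  have key : ∀ d : ℕ, ∀ a b : Fin n, a.1 + d + 1 = b.1 → p a b ∧ p b a := by
    intro d
    induction d with
    | zero =>
      intro a b h
      have hb := b.2
      let i : Fin (n - 1) := ⟨a.1, by omega⟩
      have hai : a = lo i := rfl
      have hbi : b = hi i := Fin.ext h.symm
      rw [hai, hbi]
      refine ⟨adj i, ?_⟩
      have := step i _ _ (lo_ne_hi i) (adj i)
      rwa [simpleSwap_lo, simpleSwap_hi] at this
    | succ d ih =>
      intro a b h
      have hb := b.2
      let i : Fin (n - 1) := ⟨b.1 - 1, by omega⟩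
      have hbi : b = hi i := Fin.ext (by change b.1 = b.1 - 1 + 1; omega)
      have hab : a.1 < i.1 := by change a.1 < b.1 - 1; omega
      have hne : a ≠ lo i := fun e => hab.ne (congrArg Fin.val e)
      have ha : simpleSwap i a = a := simpleSwap_far hne
        (fun e => (hab.trans (Nat.lt_succ_self _)).ne (congrArg Fin.val e))
      obtain ⟨h1, h2⟩ := ih a (lo i) (by change a.1 + d + 1 = b.1 - 1; omega)
      have h3 := step i _ _ hne h1
      have h4 := step i _ _ hne.symm h2
      rw [ha, simpleSwap_lo, ← hbi] at h3 h4
      exact ⟨h3, h4⟩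
  intro a b hab
  rcases lt_or_gt_of_ne hab with h | h
  · have h' : a.1 < b.1 := h
    exact (key (b.1 - a.1 - 1) a b (by omega)).1
  · have h' : b.1 < a.1 := h
    exact (key (a.1 - b.1 - 1) b a (by omega)).2

/-- If the simple generators permute a family `x` up to a sign `e`, then the odd transpositions,
which are products of an odd number of generators, permute it up to the same sign. -/
theorem IsSpin.oddTrans_mul {ι : Type*} [MulAction (Perm (Fin n)) ι] (ht : IsSpin t) {x : ι → A}
    {e : A} (he : e = 1 ∨ e = -1) (hx : ∀ i k, t i * x k = e * (x (simpleSwap i • k) * t i))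
    {a b : Fin n} (hab : a ≠ b) (k : ι) :
    oddTrans t a b * x k = e * (x (swap a b • k) * oddTrans t a b) := by
  revert k
  refine pair_induction (p := fun a b => ∀ k,
    oddTrans t a b * x k = e * (x (swap a b • k) * oddTrans t a b)) ?_ ?_ a b hab
  · intro i k
    rw [oddTrans_lo_hi]
    exact hx i k
  · intro i a b _ ih k
    have hs : swap (simpleSwap i a) (simpleSwap i b) =
        simpleSwap i * swap a b * simpleSwap i := by
      rw [swap_apply_apply, simpleSwap, swap_inv]
    rw [ht.oddTrans_conj, hs, mul_smul, mul_smul]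
    set L := oddTrans t a b
    set x1 := x (simpleSwap i • k)
    set x2 := x (swap a b • simpleSwap i • k)
    have e1 : t i * x k = e * (x1 * t i) := hx i k
    have e2 : L * x1 = e * (x2 * L) := ih _
    have e3 : t i * x2 = e * (x _ * t i) := hx i _
    have e4 : t i * L * t i * x k =
        e * (x (simpleSwap i • swap a b • simpleSwap i • k) * (t i * L * t i)) := by
      rcases he with rfl | rfl
      · simp only [one_mul] at *
        rw [mul_assoc, e1, ← mul_assoc, mul_assoc (t i), e2, ← mul_assoc, e3]
        simp only [mul_assoc]
      · simp only [neg_mul, one_mul] at *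
        rw [mul_assoc, e1, mul_neg, ← mul_assoc, mul_assoc (t i), e2, mul_neg, neg_mul, neg_neg,
          ← mul_assoc, e3]
        simp only [mul_assoc, neg_mul]
    rw [neg_mul, e4, mul_neg, mul_neg]

theorem IsSpin.oddTrans_mul_oddTrans (ht : IsSpin t) {a b : Fin n} (hab : a ≠ b) (c d : Fin n) :
    oddTrans t a b * oddTrans t c d =
      -(oddTrans t (swap a b c) (swap a b d) * oddTrans t a b) := by
  have := ht.oddTrans_mul (x := fun p : Fin n × Fin n => oddTrans t p.1 p.2) (Or.inr rfl)
    (fun i k => by rw [neg_one_mul]; exact ht.mul_oddTrans i k.1 k.2) hab (c, d)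
  rw [neg_one_mul] at this
  exact this

/-- A family permuted by the simple generators up to the sign `-1` is permuted by the odd
transpositions in the same way. -/
theorem IsSpin.oddTrans_mul_odd (ht : IsSpin t) {x : Fin n → A}
    (hx : ∀ i k, t i * x k = -(x (simpleSwap i k) * t i)) {a b : Fin n} (hab : a ≠ b)
    (k : Fin n) : oddTrans t a b * x k = -(x (swap a b k) * oddTrans t a b) := by
  have := ht.oddTrans_mul (x := x) (Or.inr rfl)
    (fun i k => by rw [neg_one_mul]; exact hx i k) hab k
  rw [neg_one_mul] at this
  exact this

theorem IsSpin.oddTrans_mul_even (ht : IsSpin t) {x : Fin n → A}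
    (hx : ∀ i k, t i * x k = x (simpleSwap i k) * t i) {a b : Fin n} (hab : a ≠ b)
    (k : Fin n) : oddTrans t a b * x k = x (swap a b k) * oddTrans t a b := by
  have := ht.oddTrans_mul (x := x) (Or.inl rfl)
    (fun i k => by rw [one_mul]; exact hx i k) hab k
  rw [one_mul] at this
  exact this

theorem map_ext {B F : Type*} [Ring B] [FunLike F A B] [RingHomClass F A B] (f : F)
    (t : Fin (n - 1) → A) (k : ℕ) : f (ext t k) = ext (fun i => f (t i)) k := by
  unfold ext
  split <;> simp

theorem map_oddTrans {B F : Type*} [Ring B] [FunLike F A B] [RingHomClass F A B] (f : F)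
    (t : Fin (n - 1) → A) (a b : Fin n) :
    f (oddTrans t a b) = oddTrans (fun i => f (t i)) a b := by
  have h : ∀ i j, f (oddTransAux t i j) = oddTransAux (fun i => f (t i)) i j := fun i j => by
    have hf : ∀ k, f (ext t k) = ext (fun i => f (t i)) k := map_ext f t
    simp only [oddTransAux, map_mul, map_pow, map_neg, map_one, map_list_prod, List.map_map, hf,
      Function.comp_def]
  unfold oddTrans
  split_ifs <;> simp [h]

theorem isSpin_mk {B : Type*} [Ring B] {t' : Fin (n - 1) → B}
    (sq : ∀ i, t' i * t' i = 1)
    (braid : ∀ i j : Fin (n - 1), i.1 + 1 = j.1 → t' i * t' j * t' i = t' j * t' i * t' j)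
    (anticomm : ∀ i j : Fin (n - 1), i.1 + 1 < j.1 ∨ j.1 + 1 < i.1 →
      t' i * t' j = -(t' j * t' i)) : IsSpin t' := by
  rintro _ _ (i | ⟨i, j, h⟩ | ⟨i, j, h⟩)
  exacts [sq i, braid i j h, anticomm i j h]

end OddTrans

/-! ### Presentations and universal properties -/

section Presentations

variable {n : ℕ} {A : Type*} [Ring A] [Algebra ℂ A]

theorem SpinSym.isSpin_t : IsSpin (SpinSym.t (n := n)) := by
  have key : ∀ a b, SpinRel (FreeAlgebra.ι ℂ : Fin (n - 1) → _) a b →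
      RingQuot.mkAlgHom ℂ _ a = RingQuot.mkAlgHom ℂ _ b :=
    fun a b h => RingQuot.mkAlgHom_rel ℂ h
  refine isSpin_mk (fun i => ?_) (fun i j h => ?_) (fun i j h => ?_)
  · simpa [SpinSym.t] using key _ _ (.sq i)
  · simpa [SpinSym.t] using key _ _ (.braid i j h)
  · simpa [SpinSym.t] using key _ _ (.anticomm i j h)

/-- The homomorphism out of the spin symmetric group algebra given by a family satisfying its
defining relations. -/
def SpinSym.lift {t : Fin (n - 1) → A} (ht : IsSpin t) : SpinSym n →ₐ[ℂ] A :=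
  RingQuot.liftAlgHom ℂ ⟨FreeAlgebra.lift ℂ t, by
    rintro _ _ (i | ⟨i, j, h⟩ | ⟨i, j, h⟩)
    · simpa using ht _ _ (.sq i)
    · simpa using ht _ _ (.braid i j h)
    · simpa using ht _ _ (.anticomm i j h)⟩

@[simp]
theorem SpinSym.lift_t {t : Fin (n - 1) → A} (ht : IsSpin t) (i : Fin (n - 1)) :
    SpinSym.lift ht (SpinSym.t i) = t i := by
  simp [SpinSym.lift, SpinSym.t]

/-- An algebra homomorphism out of a quotient of a free algebra is determined by the values on the
generators. -/
theorem presented_hom_ext {X : Type*} {r : FreeAlgebra ℂ X → FreeAlgebra ℂ X → Prop}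
    {f g : RingQuot r →ₐ[ℂ] A}
    (h : ∀ x, f (RingQuot.mkAlgHom ℂ r (FreeAlgebra.ι ℂ x)) =
      g (RingQuot.mkAlgHom ℂ r (FreeAlgebra.ι ℂ x))) : f = g := by
  apply RingQuot.ringQuot_ext'
  ext x
  exact h x

/-- An algebra presented by generators and relations is generated by the generators. -/
theorem presented_adjoin {X : Type*} (r : FreeAlgebra ℂ X → FreeAlgebra ℂ X → Prop) :
    Algebra.adjoin ℂ (Set.range fun x => RingQuot.mkAlgHom ℂ r (FreeAlgebra.ι ℂ x)) = ⊤ := by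
  rw [show (fun x => RingQuot.mkAlgHom ℂ r (FreeAlgebra.ι ℂ x)) =
      RingQuot.mkAlgHom ℂ r ∘ FreeAlgebra.ι ℂ from rfl, Set.range_comp, ← AlgHom.map_adjoin,
    FreeAlgebra.adjoin_range_ι, Algebra.map_top, AlgHom.range_eq_top]
  exact RingQuot.mkAlgHom_surjective ℂ r

/-- Families satisfying the defining relations of the rational spin double affine Hecke algebra,
with the relations between the `t_i` and the other generators written in terms of permutations. -/
structure IsDaha (u : ℂ) (ξ y : Fin n → A) (t : Fin (n - 1) → A) : Prop where
  spin : IsSpin t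
  xi_xi : ∀ i j, i ≠ j → ξ i * ξ j = -(ξ j * ξ i)
  y_y : ∀ i j, y i * y j = y j * y i
  t_xi : ∀ i k, t i * ξ k = -(ξ (simpleSwap i k) * t i)
  t_y : ∀ i k, t i * y k = y (simpleSwap i k) * t i
  y_xi : ∀ i j, i ≠ j → y i * ξ j - ξ j * y i = u • oddTrans t i j
  y_xi_self : ∀ i, y i * ξ i - ξ i * y i =
    u • ∑ k ∈ Finset.univ.filter (fun k : Fin n => k ≠ i), oddTrans t i k

/-- Checking a relation with a simple transposition on the lower moved position and on the fixed
positions is enough, because the `t_i` are involutions. -/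
theorem simpleSwap_even {A : Type*} [Ring A] {t : Fin (n - 1) → A} (ht : IsSpin t) {x : Fin n → A}
    (h1 : ∀ i, t i * x (lo i) = x (hi i) * t i)
    (h2 : ∀ i k, k ≠ lo i → k ≠ hi i → t i * x k = x k * t i) (i : Fin (n - 1))
    (k : Fin n) : t i * x k = x (simpleSwap i k) * t i := by
  by_cases hl : k = lo i
  · rw [hl, simpleSwap_lo, h1]
  by_cases hh : k = hi i
  · have hx : x (hi i) = t i * x (lo i) * t i := by rw [h1, mul_assoc, ht.mul_self, mul_one]
    rw [hh, simpleSwap_hi, hx, ← mul_assoc, ← mul_assoc, ht.mul_self, one_mul]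
  · rw [simpleSwap_far hl hh, h2 i k hl hh]

theorem simpleSwap_odd {A : Type*} [Ring A] {t : Fin (n - 1) → A} (ht : IsSpin t) {x : Fin n → A}
    (h1 : ∀ i, t i * x (lo i) = -(x (hi i) * t i))
    (h2 : ∀ i k, k ≠ lo i → k ≠ hi i → t i * x k = -(x k * t i)) (i : Fin (n - 1))
    (k : Fin n) : t i * x k = -(x (simpleSwap i k) * t i) := by
  by_cases hl : k = lo i
  · rw [hl, simpleSwap_lo, h1]
  by_cases hh : k = hi i
  · have hx : x (hi i) = -(t i * x (lo i) * t i) := by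
      rw [h1, neg_mul, neg_neg, mul_assoc, ht.mul_self, mul_one]
    rw [hh, simpleSwap_hi, hx, mul_neg, ← mul_assoc, ← mul_assoc, ht.mul_self, one_mul]
  · rw [simpleSwap_far hl hh, h2 i k hl hh]

theorem SpinDaha.isDaha (u : ℂ) (n : ℕ) :
    IsDaha u (SpinDaha.xi u (n := n)) (SpinDaha.y u) (SpinDaha.t u) := by
  have key : ∀ a b, DRel u n a b → RingQuot.mkAlgHom ℂ (DRel u n) a =
      RingQuot.mkAlgHom ℂ (DRel u n) b := fun a b h => RingQuot.mkAlgHom_rel ℂ h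
  have hs : IsSpin (SpinDaha.t u (n := n)) := by
    refine isSpin_mk (fun i => ?_) (fun i j h => ?_) (fun i j h => ?_)
    · simpa [SpinDaha.t] using key _ _ (.spin _ _ (.sq i))
    · simpa [SpinDaha.t] using key _ _ (.spin _ _ (.braid i j h))
    · simpa [SpinDaha.t] using key _ _ (.spin _ _ (.anticomm i j h))
  have hL : ∀ a b, RingQuot.mkAlgHom ℂ (DRel u n) (oddTrans ft a b) =
      oddTrans (SpinDaha.t u) a b := map_oddTrans (RingQuot.mkAlgHom ℂ (DRel u n)) ft
  refine ⟨hs, fun i j h => ?_, fun i j => ?_, ?_, ?_, fun i j h => ?_, fun i => ?_⟩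
  · simpa [SpinDaha.xi] using key _ _ (.xi_xi i j h)
  · by_cases h : i = j
    · rw [h]
    · simpa [SpinDaha.y] using key _ _ (.y_y i j h)
  · exact simpleSwap_odd hs
      (fun i => by simpa [SpinDaha.xi, SpinDaha.t] using key _ _ (.t_xi i))
      (fun i k h h' => by simpa [SpinDaha.xi, SpinDaha.t] using key _ _ (.t_xi_far i k h h'))
  · exact simpleSwap_even hs
      (fun i => by simpa [SpinDaha.y, SpinDaha.t] using key _ _ (.t_y i))
      (fun i k h h' => by simpa [SpinDaha.y, SpinDaha.t] using key _ _ (.t_y_far i k h h'))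
  · simpa [SpinDaha.y, SpinDaha.xi, hL] using key _ _ (.y_xi i j h)
  · simpa [SpinDaha.y, SpinDaha.xi, hL] using key _ _ (.y_xi_self i)

/-- The values of a homomorphism on the generators of the double affine Hecke algebra. -/
def dahaGenerators (ξ y : Fin n → A) (t : Fin (n - 1) → A) : DGen n → A
  | .xi i => ξ i
  | .y i => y i
  | .t i => t i

theorem IsDaha.lift_rel {u : ℂ} {ξ y : Fin n → A} {t : Fin (n - 1) → A} (h : IsDaha u ξ y t)
    ⦃a b : FreeAlgebra ℂ (DGen n)⦄ (hab : DRel u n a b) :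
    FreeAlgebra.lift ℂ (dahaGenerators ξ y t) a = FreeAlgebra.lift ℂ (dahaGenerators ξ y t) b := by
  set f := FreeAlgebra.lift ℂ (dahaGenerators ξ y t)
  have hx : ∀ i, f (fxi i) = ξ i := fun i => by simp [f, fxi, dahaGenerators]
  have hy : ∀ i, f (fy i) = y i := fun i => by simp [f, fy, dahaGenerators]
  have ht : ∀ i, f (ft i) = t i := fun i => by simp [f, ft, dahaGenerators]
  have hL : ∀ a b, f (oddTrans ft a b) = oddTrans t a b := fun a b => by
    rw [map_oddTrans, funext ht]
  rcases hab with ⟨_, _, hr⟩ | ⟨i, j, hr⟩ | ⟨i, j, hr⟩ | i | i | ⟨j, i, hr, hr'⟩ |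
    ⟨j, i, hr, hr'⟩ | ⟨i, j, hr⟩ | i
  · rcases hr with i | ⟨i, j, hr⟩ | ⟨i, j, hr⟩
    · simpa [ht] using h.spin _ _ (.sq i)
    · simpa [ht] using h.spin _ _ (.braid i j hr)
    · simpa [ht] using h.spin _ _ (.anticomm i j hr)
  · simpa [hx] using h.xi_xi i j hr
  · simpa [hy] using h.y_y i j
  · simpa [hx, ht, simpleSwap_lo] using h.t_xi i (lo i)
  · simpa [hy, ht, simpleSwap_lo] using h.t_y i (lo i)
  · simpa [hx, ht, simpleSwap_far hr hr'] using h.t_xi j i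
  · simpa [hy, ht, simpleSwap_far hr hr'] using h.t_y j i
  · simpa [hx, hy, hL] using h.y_xi i j hr
  · simpa [hx, hy, hL] using h.y_xi_self i

/-- The homomorphism out of the double affine Hecke algebra given by families satisfying its
defining relations. -/
def IsDaha.lift {u : ℂ} {ξ y : Fin n → A} {t : Fin (n - 1) → A} (h : IsDaha u ξ y t) :
    SpinDaha u n →ₐ[ℂ] A :=
  RingQuot.liftAlgHom ℂ ⟨FreeAlgebra.lift ℂ (dahaGenerators ξ y t), h.lift_rel⟩

section

variable {u : ℂ} {ξ y : Fin n → A} {t : Fin (n - 1) → A} (h : IsDaha u ξ y t)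

@[simp]
theorem IsDaha.lift_xi (i : Fin n) : h.lift (SpinDaha.xi u i) = ξ i := by
  simp [IsDaha.lift, SpinDaha.xi, fxi, dahaGenerators]

@[simp]
theorem IsDaha.lift_y (i : Fin n) : h.lift (SpinDaha.y u i) = y i := by
  simp [IsDaha.lift, SpinDaha.y, fy, dahaGenerators]

@[simp]
theorem IsDaha.lift_t (i : Fin (n - 1)) : h.lift (SpinDaha.t u i) = t i := by
  simp [IsDaha.lift, SpinDaha.t, ft, dahaGenerators]

end

/-- Families satisfying the defining relations of the degenerate spin affine Hecke algebra. -/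
structure IsAffine (b : Fin n → A) (t : Fin (n - 1) → A) : Prop where
  spin : IsSpin t
  b_b : ∀ i j, i ≠ j → b i * b j = -(b j * b i)
  b_t : ∀ i, b (hi i) * t i = -(t i * b (lo i)) + 1
  t_b_far : ∀ j i, i ≠ lo j → i ≠ hi j → t j * b i = -(b i * t j)

theorem SpinAffine.isAffine (n : ℕ) :
    IsAffine (SpinAffine.b (n := n)) (SpinAffine.t (n := n)) := by
  have key : ∀ p q, ARel n p q → RingQuot.mkAlgHom ℂ (ARel n) p = RingQuot.mkAlgHom ℂ (ARel n) q :=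
    fun p q h => RingQuot.mkAlgHom_rel ℂ h
  refine ⟨isSpin_mk (fun i => ?_) (fun i j h => ?_) (fun i j h => ?_), fun i j h => ?_,
    fun i => ?_, fun j i h h' => ?_⟩
  · simpa [SpinAffine.t] using key _ _ (.spin _ _ (.sq i))
  · simpa [SpinAffine.t] using key _ _ (.spin _ _ (.braid i j h))
  · simpa [SpinAffine.t] using key _ _ (.spin _ _ (.anticomm i j h))
  · simpa [SpinAffine.b] using key _ _ (.b_b i j h)
  · simpa [SpinAffine.b, SpinAffine.t] using key _ _ (.b_t i)
  · simpa [SpinAffine.b, SpinAffine.t] using key _ _ (.t_b_far j i h h')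

/-- The values of a homomorphism on the generators of the affine Hecke algebra. -/
def affineGenerators (b : Fin n → A) (t : Fin (n - 1) → A) : AGen n → A
  | .b i => b i
  | .t i => t i

theorem IsAffine.lift_rel {b : Fin n → A} {t : Fin (n - 1) → A} (h : IsAffine b t)
    ⦃p q : FreeAlgebra ℂ (AGen n)⦄ (hpq : ARel n p q) :
    FreeAlgebra.lift ℂ (affineGenerators b t) p = FreeAlgebra.lift ℂ (affineGenerators b t) q := by
  set f := FreeAlgebra.lift ℂ (affineGenerators b t)
  have hb : ∀ i, f (gb i) = b i := fun i => by simp [f, gb, affineGenerators]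
  have ht : ∀ i, f (gt i) = t i := fun i => by simp [f, gt, affineGenerators]
  rcases hpq with ⟨_, _, hr⟩ | ⟨i, j, hr⟩ | i | ⟨j, i, hr, hr'⟩
  · rcases hr with i | ⟨i, j, hr⟩ | ⟨i, j, hr⟩
    · simpa [ht] using h.spin _ _ (.sq i)
    · simpa [ht] using h.spin _ _ (.braid i j hr)
    · simpa [ht] using h.spin _ _ (.anticomm i j hr)
  · simpa [hb] using h.b_b i j hr
  · simpa [hb, ht] using h.b_t i
  · simpa [hb, ht] using h.t_b_far j i hr hr'

/-- The homomorphism out of the affine Hecke algebra given by families satisfying its defining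
relations. -/
def IsAffine.lift {b : Fin n → A} {t : Fin (n - 1) → A} (h : IsAffine b t) :
    SpinAffine n →ₐ[ℂ] A :=
  RingQuot.liftAlgHom ℂ ⟨FreeAlgebra.lift ℂ (affineGenerators b t), h.lift_rel⟩

section

variable {b : Fin n → A} {t : Fin (n - 1) → A} (h : IsAffine b t)

@[simp]
theorem IsAffine.lift_b (i : Fin n) : h.lift (SpinAffine.b i) = b i := by
  simp [IsAffine.lift, SpinAffine.b, gb, affineGenerators]

@[simp]
theorem IsAffine.lift_t (i : Fin (n - 1)) : h.lift (SpinAffine.t i) = t i := by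
  simp [IsAffine.lift, SpinAffine.t, gt, affineGenerators]

end

end Presentations

/-! ### The relations of the affine generators -/

section JucysMurphy

variable {n : ℕ} {A : Type*} [Ring A] {t : Fin (n - 1) → A}

/-- A permutation preserving the positions below `j` preserves a sum over these positions. -/
theorem sum_below_perm (σ : Perm (Fin n)) {j : Fin n} (hσ : ∀ k, k < j ↔ σ k < j)
    (f : Fin n → A) :
    ∑ k ∈ Finset.univ.filter (fun k : Fin n => k < j), f (σ k) =
      ∑ k ∈ Finset.univ.filter (fun k : Fin n => k < j), f k :=
  Finset.sum_equiv σ (fun k => by simpa using hσ k) (fun _ _ => rfl)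

theorem oddJM_anticomm {x : A} {j : Fin n} (σ : Perm (Fin n)) (hσ : ∀ k, k < j ↔ σ k < j)
    (hx : ∀ k, k < j → x * oddTrans t k j = -(oddTrans t (σ k) j * x)) :
    x * oddJM t j = -(oddJM t j * x) := by
  rw [oddJM, Finset.mul_sum, Finset.sum_mul, ← Finset.sum_neg_distrib,
    ← sum_below_perm σ hσ (fun k => -(oddTrans t k j * x))]
  exact Finset.sum_congr rfl fun k hk => hx k (by simpa using hk)

theorem IsSpin.oddTrans_mul_oddJM (ht : IsSpin t) {a b : Fin n} (hab : a ≠ b) {j : Fin n}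
    (ha : a < j) (hb : b < j) :
    oddTrans t a b * oddJM t j = -(oddJM t j * oddTrans t a b) := by
  refine oddJM_anticomm (swap a b) (fun k => ?_) fun k hk => ?_
  · rw [swap_apply_def]
    split_ifs with h1 h2
    · simp [h1, ha, hb]
    · simp [h2, ha, hb]
    · rfl
  · rw [ht.oddTrans_mul_oddTrans hab, swap_apply_of_ne_of_ne ha.ne' hb.ne']

theorem IsSpin.mul_oddJM_far (ht : IsSpin t) {i : Fin (n - 1)} {j : Fin n} (h : j ≠ lo i)
    (h' : j ≠ hi i) : t i * oddJM t j = -(oddJM t j * t i) := by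
  have h1 : j.1 ≠ i.1 := fun e => h (Fin.ext e)
  have h2 : j.1 ≠ i.1 + 1 := fun e => h' (Fin.ext e)
  have h3 : lo i < j ↔ hi i < j := by
    change i.1 < j.1 ↔ i.1 + 1 < j.1
    omega
  refine oddJM_anticomm (simpleSwap i) (fun k => ?_) fun k hk => ?_
  · rw [simpleSwap, swap_apply_def]
    split_ifs with h1 h2
    · rw [h1, h3]
    · rw [h2, h3]
    · rfl
  · rw [ht.mul_oddTrans, simpleSwap_far h h']

theorem IsSpin.oddJM_hi_mul (ht : IsSpin t) (i : Fin (n - 1)) :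
    oddJM t (hi i) * t i = -(t i * oddJM t (lo i)) + 1 := by
  have hset : Finset.univ.filter (fun k : Fin n => k < hi i) =
      insert (lo i) (Finset.univ.filter (fun k : Fin n => k < lo i)) := by
    ext k
    simp only [Finset.mem_filter, Finset.mem_univ, true_and, Finset.mem_insert, Fin.lt_def,
      Fin.ext_iff, lo, hi]
    omega
  rw [oddJM, hset, Finset.sum_insert (by simp), oddTrans_lo_hi, add_mul, ht.mul_self, add_comm,
    oddJM, Finset.mul_sum, Finset.sum_mul, ← Finset.sum_neg_distrib]
  congr 1
  refine Finset.sum_congr rfl fun k hk => ?_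
  have hk' : k < lo i := by simpa using hk
  rw [ht.mul_oddTrans, simpleSwap_lo, simpleSwap_far hk'.ne (hk'.trans (lo_lt_hi i)).ne, neg_neg]

end JucysMurphy

section AffineRelations

variable {n : ℕ} {A : Type*} [Ring A] [Algebra ℂ A] {u : ℂ} {ξ y : Fin n → A}
  {t : Fin (n - 1) → A}

/-- The element `𝔷_i = u⁻¹ y_i ξ_i + M_i`. -/
def zElem (u : ℂ) (ξ y : Fin n → A) (t : Fin (n - 1) → A) (i : Fin n) : A :=
  u⁻¹ • (y i * ξ i) + oddJM t i

theorem map_oddJM {A B F : Type*} [Ring A] [Ring B] [FunLike F A B] [RingHomClass F A B] (f : F)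
    (t : Fin (n - 1) → A) (i : Fin n) : f (oddJM t i) = oddJM (fun j => f (t j)) i := by
  simp only [oddJM, map_sum, map_oddTrans]

theorem map_zElem {B : Type*} [Ring B] [Algebra ℂ B] (f : A →ₐ[ℂ] B) (i : Fin n) :
    f (zElem u ξ y t i) =
      zElem u (fun j => f (ξ j)) (fun j => f (y j)) (fun j => f (t j)) i := by
  rw [zElem, map_add, map_smul, map_mul, map_oddJM]
  rfl

theorem IsDaha.lift_zElem (h : IsDaha u ξ y t) (α : ℂ) (i : Fin n) :
    h.lift (α • SpinDaha.xi u i + zElem u (SpinDaha.xi u) (SpinDaha.y u) (SpinDaha.t u) i) =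
      α • ξ i + zElem u ξ y t i := by
  rw [map_add, map_smul, map_zElem]
  simp only [IsDaha.lift_xi, IsDaha.lift_y, IsDaha.lift_t]

namespace IsDaha

variable (h : IsDaha u ξ y t)
include h

theorem oddTrans_mul_xi {a b : Fin n} (hab : a ≠ b) (k : Fin n) :
    oddTrans t a b * ξ k = -(ξ (swap a b k) * oddTrans t a b) :=
  h.spin.oddTrans_mul_odd h.t_xi hab k

theorem oddTrans_mul_y {a b : Fin n} (hab : a ≠ b) (k : Fin n) :
    oddTrans t a b * y k = y (swap a b k) * oddTrans t a b :=
  h.spin.oddTrans_mul_even h.t_y hab k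

/-- For `j < i`, the anticommutator of `ξ_j` with `M_i` comes from the summand `[j,i]` alone. -/
theorem xi_oddJM_of_lt {i j : Fin n} (hij : j < i) :
    ξ j * oddJM t i + oddJM t i * ξ j = oddTrans t j i * (ξ j - ξ i) := by
  rw [oddJM, Finset.mul_sum, Finset.sum_mul, ← Finset.sum_add_distrib,
    Finset.sum_eq_single_of_mem j (by simpa using hij)]
  · rw [mul_sub, h.oddTrans_mul_xi hij.ne i, swap_apply_right]
    abel
  · intro k hk hkj
    rw [h.oddTrans_mul_xi (by simpa using (Finset.mem_filter.mp hk).2.ne),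
      swap_apply_of_ne_of_ne hkj.symm hij.ne, add_neg_cancel]

theorem xi_oddJM_of_gt {i j : Fin n} (hij : i < j) :
    ξ j * oddJM t i + oddJM t i * ξ j = 0 := by
  rw [oddJM, Finset.mul_sum, Finset.sum_mul, ← Finset.sum_add_distrib]
  refine Finset.sum_eq_zero fun k hk => ?_
  have hk' : k < i := (Finset.mem_filter.mp hk).2
  rw [h.oddTrans_mul_xi hk'.ne, swap_apply_of_ne_of_ne (hk'.trans hij).ne' hij.ne',
    add_neg_cancel]

theorem oddJM_y_of_lt {i j : Fin n} (hij : j < i) :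
    oddJM t i * y j - y j * oddJM t i = (y i - y j) * oddTrans t j i := by
  rw [oddJM, Finset.mul_sum, Finset.sum_mul, ← Finset.sum_sub_distrib,
    Finset.sum_eq_single_of_mem j (by simpa using hij)]
  · rw [h.oddTrans_mul_y hij.ne, swap_apply_left, sub_mul]
  · intro k hk hkj
    rw [h.oddTrans_mul_y (by simpa using (Finset.mem_filter.mp hk).2.ne),
      swap_apply_of_ne_of_ne hkj.symm hij.ne, sub_self]

/-- The anticommutator of `ξ_j` with the first summand of `𝔷_i`. -/
theorem xi_y_xi (hu : u ≠ 0) {i j : Fin n} (hij : i ≠ j) :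
    ξ j * (u⁻¹ • (y i * ξ i)) + (u⁻¹ • (y i * ξ i)) * ξ j = oddTrans t j i * ξ i := by
  have h1 := h.y_xi i j hij
  have h2 : ξ j * y i = y i * ξ j - u • oddTrans t i j := by rw [← h1]; abel
  rw [mul_smul_comm, smul_mul_assoc, ← smul_add, ← mul_assoc, h2, mul_assoc (y i), h.xi_xi i j hij,
    oddTrans_comm t j i]
  rw [sub_mul, mul_assoc, smul_mul_assoc, mul_neg, sub_add_eq_add_sub, add_neg_cancel, zero_sub,
    smul_neg, smul_smul, inv_mul_cancel₀ hu, one_smul, neg_mul]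

theorem xi_z_of_lt (hu : u ≠ 0) {i j : Fin n} (hij : j < i) :
    ξ j * zElem u ξ y t i + zElem u ξ y t i * ξ j = oddTrans t j i * ξ j := by
  have h1 := h.xi_y_xi hu hij.ne'
  have h2 := h.xi_oddJM_of_lt hij
  rw [zElem, mul_add, add_mul, add_add_add_comm, h1, h2]
  noncomm_ring

theorem xi_z_of_gt (hu : u ≠ 0) {i j : Fin n} (hij : i < j) :
    ξ j * zElem u ξ y t i + zElem u ξ y t i * ξ j = oddTrans t j i * ξ i := by
  have h1 := h.xi_y_xi hu hij.ne
  have h2 := h.xi_oddJM_of_gt hij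
  rw [zElem, mul_add, add_mul, add_add_add_comm, h1, h2, add_zero]

theorem z_y_of_lt (hu : u ≠ 0) {i j : Fin n} (hij : j < i) :
    zElem u ξ y t i * y j - y j * zElem u ξ y t i = -(y j * oddTrans t j i) := by
  have h1 := h.oddJM_y_of_lt hij
  have h2 : ξ i * y j = y j * ξ i - u • oddTrans t j i := by
    rw [← h.y_xi j i hij.ne]; abel
  have h3 : (u⁻¹ • (y i * ξ i)) * y j - y j * (u⁻¹ • (y i * ξ i)) = -(y i * oddTrans t j i) := by
    rw [mul_smul_comm, smul_mul_assoc, ← smul_sub, mul_assoc, h2, mul_sub, ← mul_assoc,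
      ← mul_assoc, h.y_y i j, sub_sub_cancel_left, mul_smul_comm, smul_neg, smul_smul,
      inv_mul_cancel₀ hu, one_smul]
  rw [zElem, mul_add, add_mul, add_sub_add_comm, h1, h3]
  noncomm_ring

/-- An odd transposition of positions below `i` anticommutes with `𝔷_i`. -/
theorem oddTrans_mul_z {a b i : Fin n} (hab : a ≠ b) (ha : a < i) (hb : b < i) :
    oddTrans t a b * zElem u ξ y t i = -(zElem u ξ y t i * oddTrans t a b) := by
  have h1 : oddTrans t a b * (y i * ξ i) = -(y i * ξ i * oddTrans t a b) := by
    rw [← mul_assoc, h.oddTrans_mul_y hab, swap_apply_of_ne_of_ne ha.ne' hb.ne', mul_assoc,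
      h.oddTrans_mul_xi hab, swap_apply_of_ne_of_ne ha.ne' hb.ne', mul_neg, mul_assoc]
  rw [zElem, mul_add, add_mul, h.spin.oddTrans_mul_oddJM hab ha hb, mul_smul_comm, h1,
    smul_mul_assoc]
  rw [smul_neg, neg_add]

/-- Let `j < i`. The product `y_j ξ_j` anticommutes with `𝔷_i` because the terms with `[j,i]` from
`z_y_of_lt` and `xi_z_of_lt` cancel. The element `M_j` anticommutes with `𝔷_i` as well, because it
involves only odd transpositions of positions below `i`. -/
theorem z_z_of_lt (hu : u ≠ 0) {i j : Fin n} (hij : j < i) :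
    zElem u ξ y t i * zElem u ξ y t j = -(zElem u ξ y t j * zElem u ξ y t i) := by
  have hz := h.z_y_of_lt hu hij
  have hx := h.xi_z_of_lt hu hij
  have hM : zElem u ξ y t i * oddJM t j = -(oddJM t j * zElem u ξ y t i) := by
    rw [oddJM, Finset.mul_sum, Finset.sum_mul, ← Finset.sum_neg_distrib]
    refine Finset.sum_congr rfl fun k hk => ?_
    have hk' : k < j := (Finset.mem_filter.mp hk).2
    rw [h.oddTrans_mul_z hk'.ne (hk'.trans hij) hij, neg_neg]
  set Z := zElem u ξ y t i
  have h1 : Z * y j = y j * Z - y j * oddTrans t j i := by rw [sub_eq_add_neg, ← hz]; abel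
  have h2 : ξ j * Z = oddTrans t j i * ξ j - Z * ξ j := by rw [← hx]; abel
  have h3 : Z * (y j * ξ j) = -(y j * ξ j * Z) := by
    rw [← mul_assoc, h1, mul_assoc, h2]
    noncomm_ring
  rw [zElem, mul_add, add_mul, hM, mul_smul_comm, h3, smul_mul_assoc, smul_neg, neg_add]

/-- Replacing `𝔷_i` by `α ξ_i + 𝔷_i` does not affect anticommutativity. -/
theorem b_b_of_lt (hu : u ≠ 0) (α : ℂ) {i j : Fin n} (hij : j < i) :
    (α • ξ i + zElem u ξ y t i) * (α • ξ j + zElem u ξ y t j) =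
      -((α • ξ j + zElem u ξ y t j) * (α • ξ i + zElem u ξ y t i)) := by
  have hz := h.z_z_of_lt hu hij
  have h1 := h.xi_z_of_lt hu hij
  have h2 := h.xi_z_of_gt hu hij
  rw [oddTrans_comm t i j, neg_mul, ← h1] at h2
  set Z := zElem u ξ y t i
  set W := zElem u ξ y t j
  have h3 : ξ i * W = -(ξ j * Z + Z * ξ j) - W * ξ i := by rw [← h2]; abel
  simp only [add_mul, mul_add, smul_mul_assoc, mul_smul_comm, hz, h.xi_xi i j hij.ne', h3]
  module

/-- The elements `α ξ_i + 𝔷_i` satisfy the relations of the degenerate affine algebra. -/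
theorem isAffine (hu : u ≠ 0) (α : ℂ) :
    IsAffine (fun i => α • ξ i + zElem u ξ y t i) t := by
  refine ⟨h.spin, fun i j hij => ?_, fun i => ?_, fun j i hl hh => ?_⟩
  · rcases lt_or_gt_of_ne hij with hlt | hlt
    · exact (neg_eq_iff_eq_neg.mpr (h.b_b_of_lt hu α hlt)).symm
    · exact h.b_b_of_lt hu α hlt
  · have h1 : ξ (hi i) * t i = -(t i * ξ (lo i)) := by rw [h.t_xi, simpleSwap_lo, neg_neg]
    have h2 : y (hi i) * ξ (hi i) * t i = -(t i * (y (lo i) * ξ (lo i))) := by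
      rw [mul_assoc, h1, mul_neg, ← mul_assoc, ← mul_assoc, h.t_y, simpleSwap_lo]
    simp only [zElem, add_mul, mul_add, smul_mul_assoc, mul_smul_comm, h1, h2,
      h.spin.oddJM_hi_mul]
    module
  · have h1 : t j * ξ i = -(ξ i * t j) := by rw [h.t_xi, simpleSwap_far hl hh]
    have h2 : t j * (y i * ξ i) = -(y i * ξ i * t j) := by
      rw [← mul_assoc, h.t_y, simpleSwap_far hl hh, mul_assoc, h1, mul_neg, mul_assoc]
    simp only [zElem, add_mul, mul_add, smul_mul_assoc, mul_smul_comm, h1, h2,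
      h.spin.mul_oddJM_far hl hh]
    module

end IsDaha

end AffineRelations

/-! ### Divided differences -/

section DividedDifferences

open MvPolynomial

variable {n : ℕ}

/-- The action of permutations on polynomials by renaming the variables. -/
def permPoly (n : ℕ) : Perm (Fin n) →* Module.End ℂ (MvPolynomial (Fin n) ℂ) where
  toFun σ := (rename (R := ℂ) σ).toLinearMap
  map_one' := by
    ext1 m
    ext
    simp
  map_mul' σ τ := by
    refine LinearMap.ext fun f => ?_
    simp [rename_rename]

@[simp]
theorem permPoly_apply (σ : Perm (Fin n)) (f : MvPolynomial (Fin n) ℂ) :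
    permPoly n σ f = rename σ f := rfl

theorem dvd_X_sub_X_swap (k j i : Fin n) :
    (X k - X j : MvPolynomial (Fin n) ℂ) ∣ X i - X (swap k j i) := by
  rw [swap_apply_def]
  split_ifs with h1 h2
  · rw [h1]
  · rw [h2, ← neg_sub (X k), dvd_neg]
  · simp

theorem dvd_sub_rename_swap (k j : Fin n) (f : MvPolynomial (Fin n) ℂ) :
    (X k - X j : MvPolynomial (Fin n) ℂ) ∣ f - rename (swap k j) f := by
  induction f using MvPolynomial.induction_on with
  | C a => simp
  | add p q hp hq =>
    rw [map_add, add_sub_add_comm]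
    exact dvd_add hp hq
  | mul_X p i hp =>
    rw [map_mul, rename_X, show p * X i - rename (swap k j) p * X (swap k j i) =
      (p - rename (swap k j) p) * X i + rename (swap k j) p * (X i - X (swap k j i)) by ring]
    exact dvd_add (hp.mul_right _) ((dvd_X_sub_X_swap k j i).mul_left _)

theorem X_sub_X_ne_zero {k j : Fin n} (h : k ≠ j) :
    (X k - X j : MvPolynomial (Fin n) ℂ) ≠ 0 :=
  sub_ne_zero.mpr fun e => h (X_injective e)

/-- The divided difference operator `f ↦ (f - s_{kj} f) / (x_k - x_j)`; the value for `k = j`,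
where the denominator vanishes, is `0`. -/
def divDiff (k j : Fin n) : Module.End ℂ (MvPolynomial (Fin n) ℂ) :=
  if h : k = j then 0 else
  { toFun := fun f => (dvd_sub_rename_swap k j f).choose
    map_add' := fun f g => by
      apply mul_left_cancel₀ (X_sub_X_ne_zero h)
      rw [mul_add, ← (dvd_sub_rename_swap k j f).choose_spec,
        ← (dvd_sub_rename_swap k j g).choose_spec, ← (dvd_sub_rename_swap k j (f + g)).choose_spec,
        map_add, add_sub_add_comm]
    map_smul' := fun c f => by
      apply mul_left_cancel₀ (X_sub_X_ne_zero h)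
      rw [RingHom.id_apply, mul_smul_comm, ← (dvd_sub_rename_swap k j f).choose_spec,
        ← (dvd_sub_rename_swap k j (c • f)).choose_spec, map_smul, smul_sub] }

theorem mul_divDiff {k j : Fin n} (h : k ≠ j) (f : MvPolynomial (Fin n) ℂ) :
    (X k - X j) * divDiff k j f = f - rename (swap k j) f := by
  rw [divDiff, dif_neg h]
  exact (dvd_sub_rename_swap k j f).choose_spec.symm

theorem divDiff_comm {k j : Fin n} (h : k ≠ j) : divDiff j k = -divDiff k j := by
  refine LinearMap.ext fun f => mul_left_cancel₀ (X_sub_X_ne_zero h) ?_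
  rw [LinearMap.neg_apply, mul_neg, mul_divDiff h, swap_comm, ← mul_divDiff h.symm]
  ring

theorem rename_divDiff (σ : Perm (Fin n)) {k j : Fin n} (h : k ≠ j)
    (f : MvPolynomial (Fin n) ℂ) :
    rename σ (divDiff k j f) = divDiff (σ k) (σ j) (rename σ f) := by
  have hσ : σ k ≠ σ j := σ.injective.ne h
  apply mul_left_cancel₀ (X_sub_X_ne_zero hσ)
  rw [mul_divDiff hσ]
  have := congrArg (rename σ) (mul_divDiff h f)
  rw [map_mul, map_sub, rename_X, rename_X] at this
  rw [this, map_sub, rename_rename, rename_rename, ← Perm.coe_mul, ← Perm.coe_mul,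
    mul_swap_eq_swap_mul]

theorem divDiff_mul_self {k j : Fin n} (h : k ≠ j) : divDiff k j * divDiff k j = 0 := by
  refine LinearMap.ext fun f => mul_left_cancel₀ (X_sub_X_ne_zero h) ?_
  have h1 : divDiff k j (rename (swap k j) f) = -divDiff k j f := by
    apply mul_left_cancel₀ (X_sub_X_ne_zero h)
    rw [mul_neg, mul_divDiff h, mul_divDiff h, rename_rename, ← Perm.coe_mul, swap_mul_self,
      Perm.coe_one, rename_id_apply]
    ring
  rw [Module.End.mul_apply, mul_divDiff h, rename_divDiff _ h, swap_apply_left, swap_apply_right,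
    divDiff_comm h, LinearMap.neg_apply, h1]
  simp

theorem divDiff_commute {i j k l : Fin n} (hij : i ≠ j) (hkl : k ≠ l) (hik : i ≠ k) (hil : i ≠ l)
    (hjk : j ≠ k) (hjl : j ≠ l) :
    divDiff i j * divDiff k l = divDiff k l * divDiff i j := by
  refine LinearMap.ext fun f => mul_left_cancel₀
    (mul_ne_zero (X_sub_X_ne_zero hij) (X_sub_X_ne_zero hkl)) ?_
  have h1 := mul_divDiff hij (divDiff k l f)
  have h2 := mul_divDiff hkl (divDiff i j f)
  rw [rename_divDiff _ hkl, swap_apply_of_ne_of_ne hik.symm hjk.symm,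
    swap_apply_of_ne_of_ne hil.symm hjl.symm] at h1
  rw [rename_divDiff _ hij, swap_apply_of_ne_of_ne hik hil, swap_apply_of_ne_of_ne hjk hjl] at h2
  have h3 := mul_divDiff hkl f
  have h4 := mul_divDiff hij f
  have h5 := mul_divDiff hkl (rename (swap i j) f)
  have h6 := mul_divDiff hij (rename (swap k l) f)
  have hc : rename (swap k l) (rename (swap i j) f) = rename (swap i j) (rename (swap k l) f) := by
    rw [rename_rename, rename_rename, ← Perm.coe_mul, ← Perm.coe_mul]
    rw [(Perm.disjoint_swap_swap (by simp [*, Ne.symm])).commute.eq]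
  rw [hc] at h5
  rw [Module.End.mul_apply, Module.End.mul_apply]
  linear_combination (X k - X l) * h1 - (X i - X j) * h2 + h3 - h5 - h4 + h6

/-- The three-term relation: `Δ_{ij}Δ_{jk} + Δ_{jk}Δ_{ki} + Δ_{ki}Δ_{ij} = 0`. -/
theorem divDiff_three {i j k : Fin n} (hij : i ≠ j) (hjk : j ≠ k) (hki : k ≠ i) :
    divDiff i j * divDiff j k + divDiff j k * divDiff k i + divDiff k i * divDiff i j = 0 := by
  refine LinearMap.ext fun f => mul_left_cancel₀ (mul_ne_zero (mul_ne_zero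
    (X_sub_X_ne_zero hij) (X_sub_X_ne_zero hjk)) (X_sub_X_ne_zero hki)) ?_
  -- multiplied by all denominators, each product of two divided differences is explicit
  have key : ∀ a b c : Fin n, a ≠ b → b ≠ c → c ≠ a →
      (X a - X b) * (X b - X c) * (X c - X a) * divDiff a b (divDiff b c f) =
        (X c - X a) * (f - rename (swap b c) f) +
          (X b - X c) * (rename (swap a b) f - rename (swap a b * swap b c) f) := by
    intro a b c hab hbc hca
    have h1 := mul_divDiff hab (divDiff b c f)
    rw [rename_divDiff _ hbc, swap_apply_right, swap_apply_of_ne_of_ne hca hbc.symm] at h1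
    have h2 := mul_divDiff hbc f
    have h3 := mul_divDiff hca.symm (rename (swap a b) f)
    rw [rename_rename, ← Perm.coe_mul, show swap a c * swap a b = swap a b * swap b c by
      rw [mul_swap_eq_swap_mul (swap a b), swap_apply_right, swap_apply_of_ne_of_ne hca hbc.symm]]
      at h3
    linear_combination (X b - X c) * (X c - X a) * h1 + (X c - X a) * h2 + (X b - X c) * h3
  have e1 := key i j k hij hjk hki
  have e2 := key j k i hjk hki hij
  have e3 := key k i j hki hij hjk
  -- the three products of two transpositions are the same 3-cycle
  have cyc : ∀ a b c : Fin n, a ≠ b → c ≠ a → swap b c * swap c a = swap a b * swap b c := by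
    intro a b c hab hca
    rw [mul_swap_eq_swap_mul (swap b c), swap_apply_right, swap_apply_of_ne_of_ne hab hca.symm,
      swap_comm b a]
  rw [cyc i j k hij hki] at e2
  rw [cyc j k i hjk hij, cyc i j k hij hki] at e3
  simp only [LinearMap.add_apply, Module.End.mul_apply, LinearMap.zero_apply, mul_zero]
  linear_combination e1 + e2 + e3

/-- Multiplication by the variable `x_i`. -/
def mulX (i : Fin n) : Module.End ℂ (MvPolynomial (Fin n) ℂ) := LinearMap.mulLeft ℂ (X i)

@[simp]
theorem mulX_apply (i : Fin n) (f : MvPolynomial (Fin n) ℂ) : mulX i f = X i * f := rfl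

theorem mulX_comm (i j : Fin n) : mulX i * mulX j = mulX j * mulX i := by
  refine LinearMap.ext fun f => ?_
  simp only [Module.End.mul_apply, mulX_apply]
  ring

theorem permPoly_mul_mulX (σ : Perm (Fin n)) (i : Fin n) :
    permPoly n σ * mulX i = mulX (σ i) * permPoly n σ := by
  refine LinearMap.ext fun f => ?_
  simp

theorem permPoly_mul_divDiff (σ : Perm (Fin n)) {k j : Fin n} (h : k ≠ j) :
    permPoly n σ * divDiff k j = divDiff (σ k) (σ j) * permPoly n σ :=
  LinearMap.ext fun f => rename_divDiff σ h f

theorem divDiff_mul_mulX {k j : Fin n} (h : k ≠ j) :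
    divDiff k j * mulX k = mulX k * divDiff k j + permPoly n (swap k j) := by
  refine LinearMap.ext fun f => mul_left_cancel₀ (X_sub_X_ne_zero h) ?_
  have h1 := mul_divDiff h (X k * f)
  have h2 := mul_divDiff h f
  rw [map_mul (rename _), rename_X, swap_apply_left] at h1
  simp only [Module.End.mul_apply, LinearMap.add_apply, mulX_apply, permPoly_apply]
  linear_combination h1 - X k * h2

theorem divDiff_mul_mulX' {k j : Fin n} (h : k ≠ j) :
    divDiff k j * mulX j = mulX j * divDiff k j - permPoly n (swap k j) := by
  refine LinearMap.ext fun f => mul_left_cancel₀ (X_sub_X_ne_zero h) ?_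
  have h1 := mul_divDiff h (X j * f)
  have h2 := mul_divDiff h f
  rw [map_mul (rename _), rename_X, swap_apply_right] at h1
  simp only [Module.End.mul_apply, LinearMap.sub_apply, mulX_apply, permPoly_apply]
  linear_combination h1 - X j * h2

theorem divDiff_mul_mulX_far {k j i : Fin n} (h : k ≠ j) (hik : i ≠ k) (hij : i ≠ j) :
    divDiff k j * mulX i = mulX i * divDiff k j := by
  refine LinearMap.ext fun f => mul_left_cancel₀ (X_sub_X_ne_zero h) ?_
  have h1 := mul_divDiff h (X i * f)
  have h2 := mul_divDiff h f
  rw [map_mul (rename _), rename_X, swap_apply_of_ne_of_ne hik hij] at h1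
  simp only [Module.End.mul_apply, mulX_apply]
  linear_combination h1 - X i * h2

/-- The polynomials of degree less than `N`; the strict inequality makes `N = 0` give only the
zero polynomial. -/
def degBelow (n N : ℕ) : Submodule ℂ (MvPolynomial (Fin n) ℂ) where
  carrier := {f | ∀ m : Fin n →₀ ℕ, N ≤ m.degree → coeff m f = 0}
  zero_mem' := fun m _ => coeff_zero m
  add_mem' := fun hf hg m hm => by rw [coeff_add, hf m hm, hg m hm, add_zero]
  smul_mem' := fun c f hf m hm => by rw [coeff_smul, hf m hm, smul_zero]

theorem mem_degBelow_iff {N : ℕ} {f : MvPolynomial (Fin n) ℂ} :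
    f ∈ degBelow n N ↔ f = 0 ∨ f.totalDegree < N := by
  constructor
  · intro hf
    by_contra! hc
    obtain ⟨m, hm, hmd⟩ := Finset.exists_mem_eq_sup f.support
      (support_nonempty.mpr hc.1) fun s => s.sum fun _ e => e
    refine mem_support_iff.mp hm (hf m ?_)
    exact hc.2.trans_eq hmd
  · rintro (rfl | hf)
    · exact zero_mem _
    · intro m hm
      exact coeff_eq_zero_of_totalDegree_lt (hf.trans_le hm)

theorem degBelow_mono {N N' : ℕ} (h : N ≤ N') : degBelow n N ≤ degBelow n N' :=
  fun _ hf m hm => hf m (h.trans hm)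

theorem rename_mem_degBelow (σ : Perm (Fin n)) {N : ℕ} {f : MvPolynomial (Fin n) ℂ}
    (hf : f ∈ degBelow n N) : rename σ f ∈ degBelow n N := by
  rw [mem_degBelow_iff] at *
  rcases hf with rfl | hf
  · simp
  · exact Or.inr ((totalDegree_rename_le σ f).trans_lt hf)

theorem divDiff_mulX_mem_degBelow {k j : Fin n} (h : k ≠ j) (i : Fin n) {N : ℕ}
    {f : MvPolynomial (Fin n) ℂ} (hf : f ∈ degBelow n N) :
    X i * divDiff k j f ∈ degBelow n N := by
  have hs : (X k - X j) * divDiff k j f ∈ degBelow n N := by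
    rw [mul_divDiff h]
    exact sub_mem hf (rename_mem_degBelow _ hf)
  rw [mem_degBelow_iff] at *
  by_cases h0 : divDiff k j f = 0
  · simp [h0]
  right
  have hX : (X k - X j : MvPolynomial (Fin n) ℂ).totalDegree ≠ 0 := by
    intro hd
    have := totalDegree_eq_zero_iff_eq_C.mp hd
    have hc := congrArg (eval 0) this
    rw [map_sub, eval_X, eval_X, eval_C, Pi.zero_apply, Pi.zero_apply, sub_self] at hc
    rw [← hc, C_0] at this
    exact X_sub_X_ne_zero h this
  have hlt := hs.resolve_left (mul_ne_zero (X_sub_X_ne_zero h) h0)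
  rw [totalDegree_mul_of_isDomain (X_sub_X_ne_zero h) h0] at hlt
  have := totalDegree_mul (X i) (divDiff k j f)
  rw [totalDegree_X] at this
  omega

theorem divDiff_mem_degBelow {k j : Fin n} (h : k ≠ j) {N : ℕ}
    {f : MvPolynomial (Fin n) ℂ} (hf : f ∈ degBelow n N) : divDiff k j f ∈ degBelow n N := by
  by_cases h0 : divDiff k j f = 0
  · simp [h0]
  have := divDiff_mulX_mem_degBelow h k hf
  rw [mem_degBelow_iff] at *
  right
  have hlt := this.resolve_left (mul_ne_zero (X_ne_zero k) h0)
  rw [totalDegree_mul_of_isDomain (X_ne_zero k) h0] at hlt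
  omega

theorem X_mul_mem_degBelow (i : Fin n) {N : ℕ} {f : MvPolynomial (Fin n) ℂ}
    (hf : f ∈ degBelow n N) : X i * f ∈ degBelow n (N + 1) := by
  rw [mem_degBelow_iff] at *
  rcases hf with rfl | hf
  · simp
  · have := totalDegree_mul (X i) f
    rw [totalDegree_X] at this
    exact Or.inr (by omega)

end DividedDifferences

/-! ### Commuting pairs of algebras -/

section Outer

variable {E R T : Type*} [Ring E] [Algebra ℂ E] [Ring R] [Algebra ℂ R] [Ring T] [Algebra ℂ T]

/-- The product in `T` of an element of `E` and an element of `R`, for two homomorphisms `φ` and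
`ψ` to `T` with commuting images. For `T = E ⊗ R` this is the pure tensor `a ⊗ b`. -/
def outer (φ : E →ₐ[ℂ] T) (ψ : R →ₐ[ℂ] T) (a : E) (b : R) : T := φ a * ψ b

variable {φ : E →ₐ[ℂ] T} {ψ : R →ₐ[ℂ] T}

theorem outer_mul (hc : ∀ a b, Commute (φ a) (ψ b)) (a a' : E) (b b' : R) :
    outer φ ψ a b * outer φ ψ a' b' = outer φ ψ (a * a') (b * b') := by
  simp only [outer, map_mul]
  rw [mul_assoc, ← mul_assoc (ψ b), ← (hc a' b).eq]
  simp only [mul_assoc]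

theorem outer_one_one : outer φ ψ 1 1 = 1 := by simp [outer]

theorem outer_neg (a : E) (b : R) : outer φ ψ a (-b) = -outer φ ψ a b := by simp [outer]

theorem neg_outer (a : E) (b : R) : outer φ ψ (-a) b = -outer φ ψ a b := by simp [outer]

theorem outer_zero (a : E) : outer φ ψ a 0 = 0 := by simp [outer]

theorem zero_outer (b : R) : outer φ ψ 0 b = 0 := by simp [outer]

theorem outer_add (a : E) (b b' : R) : outer φ ψ a (b + b') = outer φ ψ a b + outer φ ψ a b' := by
  simp [outer, mul_add]

theorem add_outer (a a' : E) (b : R) : outer φ ψ (a + a') b = outer φ ψ a b + outer φ ψ a' b := by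
  simp [outer, add_mul]

theorem sub_outer (a a' : E) (b : R) : outer φ ψ (a - a') b = outer φ ψ a b - outer φ ψ a' b := by
  simp [outer, sub_mul]

end Outer

/-! ### Twisting by a representation of the symmetric group -/

section Twist

variable {n : ℕ} {E R T : Type*} [Ring E] [Algebra ℂ E] [Ring R] [Algebra ℂ R] [Ring T]
  [Algebra ℂ T]

/-- The generators `t_i` multiplied, in the sense of `outer`, by the simple transpositions, which
act through a representation `π` of the symmetric group. -/
def twist (φ : E →ₐ[ℂ] T) (ψ : R →ₐ[ℂ] T) (π : Perm (Fin n) →* E) (t : Fin (n - 1) → R)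
    (i : Fin (n - 1)) : T :=
  outer φ ψ (π (simpleSwap i)) (t i)

theorem simpleSwap_braid {i j : Fin (n - 1)} (h : i.1 + 1 = j.1) :
    simpleSwap i * simpleSwap j * simpleSwap i = simpleSwap j * simpleSwap i * simpleSwap j := by
  have hj : lo j = hi i := Fin.ext h.symm
  have h1 : lo i ≠ hi i := lo_ne_hi i
  have h2 : hi i ≠ hi j := hj ▸ lo_ne_hi j
  have h3 : lo i ≠ hi j := ((lo_lt_hi i).trans (hj ▸ lo_lt_hi j)).ne
  have e1 : simpleSwap i * simpleSwap j * simpleSwap i = swap (lo i) (hi j) := by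
    have := swap_apply_apply (simpleSwap i) (lo j) (hi j)
    rw [simpleSwap, swap_inv, ← simpleSwap, hj, simpleSwap_hi, simpleSwap_far h3.symm h2.symm]
      at this
    rw [this, simpleSwap, simpleSwap, hj]
  have e2 : simpleSwap j * simpleSwap i * simpleSwap j = swap (lo i) (hi j) := by
    have := swap_apply_apply (simpleSwap j) (lo i) (hi i)
    rw [simpleSwap, swap_inv, ← simpleSwap, ← hj, simpleSwap_lo,
      simpleSwap_far (hj ▸ h1) h3] at this
    rw [this, simpleSwap, simpleSwap, hj]
  rw [e1, e2]

theorem simpleSwap_commute {i j : Fin (n - 1)} (h : i.1 + 1 < j.1 ∨ j.1 + 1 < i.1) :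
    simpleSwap i * simpleSwap j = simpleSwap j * simpleSwap i := by
  refine (Perm.disjoint_swap_swap ?_).commute.eq
  simp only [List.nodup_cons, List.mem_cons, List.not_mem_nil, lo, hi, Fin.ext_iff]
  simp
  omega

variable {φ : E →ₐ[ℂ] T} {ψ : R →ₐ[ℂ] T} {π : Perm (Fin n) →* E} {t : Fin (n - 1) → R}

theorem IsSpin.twist (ht : IsSpin t) (hc : ∀ a b, Commute (φ a) (ψ b)) :
    IsSpin (twist φ ψ π t) := by
  refine isSpin_mk (fun i => ?_) (fun i j h => ?_) (fun i j h => ?_)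
  · rw [SpinHecke.twist, outer_mul hc, ← map_mul, simpleSwap_mul_self, ht.mul_self, map_one,
      outer_one_one]
  · simp only [SpinHecke.twist, outer_mul hc, ← map_mul]
    rw [simpleSwap_braid h, ht _ _ (.braid i j h)]
  · simp only [SpinHecke.twist, outer_mul hc, ← map_mul]
    rw [simpleSwap_commute h, ht _ _ (.anticomm i j h), outer_neg]

/-- The signs in the definition of the odd transpositions do not affect the factor in the symmetric
group, where conjugation by simple transpositions produces the transpositions. -/
theorem oddTrans_twist (ht : IsSpin t) (hc : ∀ a b, Commute (φ a) (ψ b)) {a b : Fin n}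
    (hab : a ≠ b) :
    oddTrans (twist φ ψ π t) a b = outer φ ψ (π (swap a b)) (oddTrans t a b) := by
  refine pair_induction (p := fun a b =>
    oddTrans (twist φ ψ π t) a b = outer φ ψ (π (swap a b)) (oddTrans t a b)) (fun i => ?_)
    (fun i a b _ ih => ?_) a b hab
  · rw [oddTrans_lo_hi, oddTrans_lo_hi]
    rfl
  · rw [(ht.twist hc).oddTrans_conj, ht.oddTrans_conj, ih, swap_apply_apply]
    simp only [twist, outer_mul hc, outer_neg, map_mul, simpleSwap, swap_inv]

end Twist

/-! ### The Dunkl representation -/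

section Dunkl

variable {n : ℕ} {E R T : Type*} [Ring E] [Algebra ℂ E] [Ring R] [Algebra ℂ R] [Ring T]
  [Algebra ℂ T]

/-- Families `c` and `t` such that the `c_i` anticommute and are permuted by the `t_i` up to the
sign `-1`, while the `t_i` satisfy the relations of the spin symmetric group algebra. -/
structure IsSkew (c : Fin n → R) (t : Fin (n - 1) → R) : Prop where
  spin : IsSpin t
  c_c : ∀ i j, i ≠ j → c i * c j = -(c j * c i)
  t_c : ∀ i k, t i * c k = -(c (simpleSwap i k) * t i)

/-- The identities between the multiplications `X` by variables, the divided differences `Δ` and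
the permutations `π` of the variables. -/
structure IsDivDiff (X : Fin n → E) (Δ : Fin n → Fin n → E) (π : Perm (Fin n) →* E) : Prop where
  X_X : ∀ i j, X i * X j = X j * X i
  perm_X : ∀ σ i, π σ * X i = X (σ i) * π σ
  perm_diff : ∀ σ k j, k ≠ j → π σ * Δ k j = Δ (σ k) (σ j) * π σ
  comm : ∀ k j, k ≠ j → Δ j k = -Δ k j
  sq : ∀ k j, k ≠ j → Δ k j * Δ k j = 0
  commute : ∀ i j k l, i ≠ j → k ≠ l → i ≠ k → i ≠ l → j ≠ k → j ≠ l →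
    Δ i j * Δ k l = Δ k l * Δ i j
  three : ∀ i j k, i ≠ j → j ≠ k → k ≠ i → Δ i j * Δ j k + Δ j k * Δ k i + Δ k i * Δ i j = 0
  diff_X : ∀ k j, k ≠ j → Δ k j * X k = X k * Δ k j + π (swap k j)
  diff_X' : ∀ k j, k ≠ j → Δ k j * X j = X j * Δ k j - π (swap k j)
  diff_X_far : ∀ k j i, k ≠ j → i ≠ k → i ≠ j → Δ k j * X i = X i * Δ k j

theorem isDivDiff_divDiff : IsDivDiff (mulX (n := n)) divDiff (permPoly n) where
  X_X := mulX_comm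
  perm_X := permPoly_mul_mulX
  perm_diff _ _ _ h := permPoly_mul_divDiff _ h
  comm _ _ h := divDiff_comm h
  sq _ _ h := divDiff_mul_self h
  commute _ _ _ _ := divDiff_commute
  three _ _ _ := divDiff_three
  diff_X _ _ := divDiff_mul_mulX
  diff_X' _ _ := divDiff_mul_mulX'
  diff_X_far _ _ _ := divDiff_mul_mulX_far

/-- The operator `Δ_{kj} ⊗ [k,j]`, the summand of the Dunkl operator belonging to a pair. -/
def dunklTerm (φ : E →ₐ[ℂ] T) (ψ : R →ₐ[ℂ] T) (Δ : Fin n → Fin n → E) (t : Fin (n - 1) → R)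
    (k j : Fin n) : T :=
  outer φ ψ (Δ k j) (oddTrans t k j)

/-- The odd Dunkl operator `1 ⊗ c_j - u ∑_k Δ_{kj} ⊗ [k,j]`, by which `ξ_j` acts. The summand for
`k = j` is zero. -/
def dunkl (φ : E →ₐ[ℂ] T) (ψ : R →ₐ[ℂ] T) (Δ : Fin n → Fin n → E) (u : ℂ) (c : Fin n → R)
    (t : Fin (n - 1) → R) (j : Fin n) : T :=
  outer φ ψ 1 (c j) - u • ∑ k, dunklTerm φ ψ Δ t k j

/-- Multiplication by `x_i`, by which `y_i` acts. -/
def dunklY (φ : E →ₐ[ℂ] T) (ψ : R →ₐ[ℂ] T) (X : Fin n → E) (i : Fin n) : T :=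
  outer φ ψ (X i) 1

variable {φ : E →ₐ[ℂ] T} {ψ : R →ₐ[ℂ] T} {X : Fin n → E} {Δ : Fin n → Fin n → E}
  {π : Perm (Fin n) →* E} {t : Fin (n - 1) → R}

theorem dunklTerm_self (k : Fin n) : dunklTerm φ ψ Δ t k k = 0 := by
  rw [dunklTerm, oddTrans_self, outer_zero]

theorem dunklTerm_comm (hd : IsDivDiff X Δ π) (k j : Fin n) :
    dunklTerm φ ψ Δ t k j = dunklTerm φ ψ Δ t j k := by
  by_cases h : k = j
  · rw [h]
  · rw [dunklTerm, dunklTerm, hd.comm _ _ h, oddTrans_comm t j k, neg_outer, outer_neg,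
      neg_neg]

theorem dunklTerm_mul_self (hd : IsDivDiff X Δ π) (hc : ∀ a b, Commute (φ a) (ψ b))
    (k j : Fin n) : dunklTerm φ ψ Δ t k j * dunklTerm φ ψ Δ t k j = 0 := by
  by_cases h : k = j
  · rw [h, dunklTerm_self, mul_zero]
  · rw [dunklTerm, outer_mul hc, hd.sq _ _ h, zero_outer]

theorem dunklTerm_anticomm (hd : IsDivDiff X Δ π)
    (hc : ∀ a b, Commute (φ a) (ψ b)) (ht : IsSpin t) {i j k l : Fin n} (hij : i ≠ j) (hkl : k ≠ l)
    (hik : i ≠ k) (hil : i ≠ l) (hjk : j ≠ k) (hjl : j ≠ l) :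
    dunklTerm φ ψ Δ t i j * dunklTerm φ ψ Δ t k l +
      dunklTerm φ ψ Δ t k l * dunklTerm φ ψ Δ t i j = 0 := by
  rw [dunklTerm, dunklTerm, outer_mul hc, outer_mul hc,
    hd.commute _ _ _ _ hij hkl hik hil hjk hjl,
    ht.oddTrans_mul_oddTrans hij, swap_apply_of_ne_of_ne hik.symm hjk.symm,
    swap_apply_of_ne_of_ne hil.symm hjl.symm, outer_neg, neg_add_cancel]

/-- Three odd transpositions in cyclic order have equal products of neighbours, so the three-term
relation of the divided differences carries over to the pair terms. -/
theorem dunklTerm_three (hd : IsDivDiff X Δ π)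
    (hc : ∀ a b, Commute (φ a) (ψ b)) (ht : IsSpin t) {i j k : Fin n} (hij : i ≠ j) (hjk : j ≠ k)
    (hki : k ≠ i) :
    dunklTerm φ ψ Δ t i j * dunklTerm φ ψ Δ t j k + dunklTerm φ ψ Δ t j k * dunklTerm φ ψ Δ t k i +
      dunklTerm φ ψ Δ t k i * dunklTerm φ ψ Δ t i j = 0 := by
  -- the three products of odd transpositions coincide
  have cyc : ∀ a b c : Fin n, a ≠ b → b ≠ c → c ≠ a →
      oddTrans t a b * oddTrans t b c = oddTrans t c a * oddTrans t a b := by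
    intro a b c hab hbc hca
    rw [ht.oddTrans_mul_oddTrans hab, swap_apply_right, swap_apply_of_ne_of_ne hca hbc.symm,
      oddTrans_comm t a c, neg_mul, neg_neg]
  simp only [dunklTerm, outer_mul hc]
  rw [← cyc i j k hij hjk hki, cyc j k i hjk hki hij, ← add_outer,
    ← add_outer, hd.three _ _ _ hij hjk hki, zero_outer]

/-- The anticommutator of the sums of pair terms vanishes: the pair `{i,j}` contributes a square,
disjoint pairs anticommute, and the remaining terms are grouped by the third position. -/
theorem sum_dunklTerm_anticomm (hd : IsDivDiff X Δ π)
    (hc : ∀ a b, Commute (φ a) (ψ b)) (ht : IsSpin t) {i j : Fin n} (hij : i ≠ j) :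
    (∑ k, dunklTerm φ ψ Δ t k i) * (∑ k, dunklTerm φ ψ Δ t k j) +
      (∑ k, dunklTerm φ ψ Δ t k j) * (∑ k, dunklTerm φ ψ Δ t k i) = 0 := by
  set K := Finset.univ.filter (fun k : Fin n => k ≠ i ∧ k ≠ j) with hK
  have hmem : ∀ k ∈ K, k ≠ i ∧ k ≠ j := fun k hk => by simpa [hK] using hk
  have split : ∀ f : Fin n → T,
      ∑ k, f k = f i + f j + ∑ k ∈ K, f k := by
    intro f
    have : (Finset.univ : Finset (Fin n)) = insert i (insert j K) := by
      ext k
      simp only [hK, Finset.mem_univ, Finset.mem_insert, Finset.mem_filter, true_and, true_iff]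
      tauto
    rw [this, Finset.sum_insert, Finset.sum_insert, add_assoc]
    · simp [hK]
    · simp [hK, hij]
  rw [split fun k => dunklTerm φ ψ Δ t k i, split fun k => dunklTerm φ ψ Δ t k j, dunklTerm_self,
    dunklTerm_self, zero_add, add_zero, dunklTerm_comm hd j i]
  have hsq := dunklTerm_mul_self (t := t) hd hc i j
  set p := dunklTerm φ ψ Δ t i j
  have cross : (∑ k ∈ K, dunklTerm φ ψ Δ t k i) * (∑ k ∈ K, dunklTerm φ ψ Δ t k j) +
      (∑ k ∈ K, dunklTerm φ ψ Δ t k j) * (∑ k ∈ K, dunklTerm φ ψ Δ t k i) =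
      ∑ k ∈ K, (dunklTerm φ ψ Δ t k i * dunklTerm φ ψ Δ t k j +
        dunklTerm φ ψ Δ t k j * dunklTerm φ ψ Δ t k i) := by
    rw [Finset.sum_mul_sum, Finset.sum_mul_sum, Finset.sum_comm (s := K) (t := K)
      (f := fun a b => dunklTerm φ ψ Δ t a j * dunklTerm φ ψ Δ t b i), ← Finset.sum_add_distrib]
    refine Finset.sum_congr rfl fun k hk => ?_
    rw [← Finset.sum_add_distrib]
    refine Finset.sum_eq_single_of_mem k hk fun l hl hlk => ?_
    exact dunklTerm_anticomm hd hc ht (hmem k hk).1 (hmem l hl).2 hlk.symm (hmem k hk).2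
      (hmem l hl).1.symm hij
  calc _ = 2 * (p * p) + ((p * ∑ k ∈ K, dunklTerm φ ψ Δ t k j) +
        (∑ k ∈ K, dunklTerm φ ψ Δ t k j) * p +
        (p * ∑ k ∈ K, dunklTerm φ ψ Δ t k i) + (∑ k ∈ K, dunklTerm φ ψ Δ t k i) * p +
        ((∑ k ∈ K, dunklTerm φ ψ Δ t k i) * (∑ k ∈ K, dunklTerm φ ψ Δ t k j) +
          (∑ k ∈ K, dunklTerm φ ψ Δ t k j) * (∑ k ∈ K, dunklTerm φ ψ Δ t k i))) := by noncomm_ring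
    _ = 0 := by
      rw [hsq, mul_zero, zero_add, cross, Finset.mul_sum, Finset.mul_sum, Finset.sum_mul,
        Finset.sum_mul, ← Finset.sum_add_distrib, ← Finset.sum_add_distrib,
        ← Finset.sum_add_distrib, ← Finset.sum_add_distrib]
      refine Finset.sum_eq_zero fun k hk => ?_
      obtain ⟨hki, hkj⟩ := hmem k hk
      have h1 := dunklTerm_three hd hc ht hij hkj.symm hki
      have h2 := dunklTerm_three hd hc ht hij.symm hki.symm hkj
      rw [dunklTerm_comm hd j k] at h1
      rw [dunklTerm_comm hd j i, dunklTerm_comm hd i k] at h2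
      rw [← add_zero (0 : T)]
      nth_rewrite 1 [← h1]
      rw [← h2]
      abel

variable {c : Fin n → R}

/-- Only the pair `{i,j}` contributes, since the other odd transpositions in the sum fix `i` and
so anticommute with `c_i`. The result is symmetric under `i ↔ j` up to sign, and cancels in the
anticommutator of two Dunkl operators. -/
theorem c_sum_dunklTerm (hc : ∀ a b, Commute (φ a) (ψ b)) (h : IsSkew c t) {i j : Fin n}
    (hij : i ≠ j) :
    outer φ ψ 1 (c i) * (∑ k, dunklTerm φ ψ Δ t k j) +
        (∑ k, dunklTerm φ ψ Δ t k j) * outer φ ψ 1 (c i) =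
      outer φ ψ (Δ i j) ((c i - c j) * oddTrans t i j) := by
  rw [Finset.mul_sum, Finset.sum_mul, ← Finset.sum_add_distrib,
    Finset.sum_eq_single_of_mem i (Finset.mem_univ i)]
  · rw [dunklTerm, outer_mul hc, outer_mul hc,
      one_mul, mul_one, ← outer_add, h.spin.oddTrans_mul_odd h.t_c hij,
      swap_apply_left, sub_mul, sub_eq_add_neg]
  · intro k _ hki
    by_cases hkj : k = j
    · rw [hkj, dunklTerm_self, mul_zero, zero_mul, add_zero]
    · rw [dunklTerm, outer_mul hc, outer_mul hc,
        one_mul, mul_one, ← outer_add, h.spin.oddTrans_mul_odd h.t_c hkj,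
        swap_apply_of_ne_of_ne hki.symm hij, add_neg_cancel, outer_zero]

theorem dunkl_anticomm (hd : IsDivDiff X Δ π) (hc : ∀ a b, Commute (φ a) (ψ b))
    (h : IsSkew c t) (u : ℂ) {i j : Fin n} (hij : i ≠ j) :
    dunkl φ ψ Δ u c t i * dunkl φ ψ Δ u c t j = -(dunkl φ ψ Δ u c t j * dunkl φ ψ Δ u c t i) := by
  have h1 := c_sum_dunklTerm (Δ := Δ) hc h hij
  have h2 := c_sum_dunklTerm (Δ := Δ) hc h hij.symm
  rw [hd.comm _ _ hij, oddTrans_comm t j i, neg_outer, mul_neg,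
    outer_neg, neg_neg, ← neg_sub (c i), neg_mul, outer_neg, ← h1] at h2
  have h3 := sum_dunklTerm_anticomm hd hc h.spin hij
  have h4 : outer φ ψ 1 (c i) * outer φ ψ 1 (c j) =
      -(outer φ ψ 1 (c j) * outer φ ψ 1 (c i)) := by
    rw [outer_mul hc, outer_mul hc, h.c_c i j hij, outer_neg]
  simp only [dunkl]
  set S := ∑ k, dunklTerm φ ψ Δ t k i
  set T := ∑ k, dunklTerm φ ψ Δ t k j
  set a := outer φ ψ 1 (c i)
  set b := outer φ ψ 1 (c j)
  have h5 : S * T = -(T * S) := eq_neg_of_add_eq_zero_left h3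
  have h6 : b * S = -(a * T + T * a) - S * b := by rw [← h2]; abel
  simp only [sub_mul, mul_sub, smul_mul_assoc, mul_smul_comm, h4, h5, h6]
  module

theorem twist_mul_dunklTerm (hd : IsDivDiff X Δ π)
    (hc : ∀ a b, Commute (φ a) (ψ b)) (ht : IsSpin t) (i : Fin (n - 1)) (k j : Fin n) :
    twist φ ψ π t i * dunklTerm φ ψ Δ t k j =
      -(dunklTerm φ ψ Δ t (simpleSwap i k) (simpleSwap i j) * twist φ ψ π t i) := by
  by_cases h : k = j
  · rw [h, dunklTerm_self, dunklTerm_self, mul_zero, zero_mul, neg_zero]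
  · rw [twist, dunklTerm, dunklTerm, outer_mul hc, outer_mul hc, hd.perm_diff _ _ _ h,
      ht.mul_oddTrans, outer_neg]

/-- The Dunkl representation of the rational spin double affine Hecke algebra. -/
theorem isDaha_dunkl (hd : IsDivDiff X Δ π) (hc : ∀ a b, Commute (φ a) (ψ b))
    (h : IsSkew c t) (u : ℂ) :
    IsDaha u (dunkl φ ψ Δ u c t) (dunklY φ ψ X) (twist φ ψ π t) := by
  have hcomm : ∀ i j, dunklY φ ψ X i * dunkl φ ψ Δ u c t j - dunkl φ ψ Δ u c t j * dunklY φ ψ X i =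
      u • ∑ k, outer φ ψ (Δ k j * X i - X i * Δ k j) (oddTrans t k j) := by
    intro i j
    have h1 : dunklY φ ψ X i * outer φ ψ 1 (c j) = outer φ ψ 1 (c j) * dunklY φ ψ X i := by
      simp only [dunklY, outer_mul hc, one_mul, mul_one]
    simp only [dunkl, mul_sub, sub_mul, h1, mul_smul_comm, smul_mul_assoc, Finset.mul_sum,
      Finset.sum_mul, sub_outer, Finset.sum_sub_distrib, smul_sub]
    simp only [dunklY, dunklTerm, outer_mul hc, one_mul, mul_one]
    abel
  refine ⟨h.spin.twist hc, fun i j hij => dunkl_anticomm hd hc h u hij, fun i j => ?_,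
    fun i k => ?_, fun i k => ?_, fun i j hij => ?_, fun i => ?_⟩
  · rw [dunklY, dunklY, outer_mul hc, outer_mul hc, hd.X_X]
  · have h1 : twist φ ψ π t i * outer φ ψ 1 (c k) =
        -(outer φ ψ 1 (c (simpleSwap i k)) * twist φ ψ π t i) := by
      rw [twist, outer_mul hc, outer_mul hc, h.t_c, one_mul, mul_one,
        outer_neg]
    have h2 : twist φ ψ π t i * (∑ l, dunklTerm φ ψ Δ t l k) =
        -((∑ l, dunklTerm φ ψ Δ t l (simpleSwap i k)) * twist φ ψ π t i) := by
      rw [← Equiv.sum_comp (simpleSwap i) fun l => dunklTerm φ ψ Δ t l (simpleSwap i k),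
        Finset.mul_sum, Finset.sum_mul, ← Finset.sum_neg_distrib]
      exact Finset.sum_congr rfl fun l _ => twist_mul_dunklTerm hd hc h.spin i l k
    rw [dunkl, dunkl, mul_sub, sub_mul, mul_smul_comm, smul_mul_assoc, h1, h2, smul_neg]
    abel
  · rw [twist, dunklY, dunklY, outer_mul hc, outer_mul hc, hd.perm_X, one_mul, mul_one]
  · rw [hcomm, Finset.sum_eq_single_of_mem i (Finset.mem_univ i), hd.diff_X _ _ hij,
      add_sub_cancel_left, oddTrans_twist h.spin hc hij]
    intro k _ hki
    by_cases hkj : k = j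
    · rw [hkj, oddTrans_self, outer_zero]
    · rw [hd.diff_X_far _ _ _ hkj hki.symm hij, sub_self, zero_outer]
  · rw [hcomm, Finset.sum_filter]
    congr 1
    refine Finset.sum_congr rfl fun k _ => ?_
    split_ifs with hki
    · rw [hd.diff_X' _ _ hki, sub_sub_cancel_left, oddTrans_twist h.spin hc (Ne.symm hki),
        swap_comm, oddTrans_comm t k, neg_outer, outer_neg, neg_neg]
    · rw [not_not.mp hki, oddTrans_self, outer_zero]

/-- The leading term of `α ξ_i + 𝔷_i` in the Dunkl representation is `u⁻¹ x_i ⊗ c_i`, the rest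
lying in every subalgebra which contains the operators not raising the degree in `x`. -/
theorem dunkl_leadingTerm (hc : ∀ a b, Commute (φ a) (ψ b)) (ht : IsSpin t) {u : ℂ} (hu : u ≠ 0)
    (α : ℂ) {F : Subalgebra ℂ T} (hF1 : ∀ r, outer φ ψ 1 r ∈ F)
    (hFdiff : ∀ k j r, k ≠ j → outer φ ψ (Δ k j) r ∈ F)
    (hFX : ∀ i k j r, k ≠ j → outer φ ψ (X i * Δ k j) r ∈ F)
    (hFperm : ∀ σ r, outer φ ψ (π σ) r ∈ F) (i : Fin n) :
    α • dunkl φ ψ Δ u c t i +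
      zElem u (dunkl φ ψ Δ u c t) (dunklY φ ψ X) (twist φ ψ π t) i -
        u⁻¹ • outer φ ψ (X i) (c i) ∈ F := by
  have hYD : dunklY φ ψ X i * dunkl φ ψ Δ u c t i = outer φ ψ (X i) (c i) -
      u • ∑ k, outer φ ψ (X i * Δ k i) (oddTrans t k i) := by
    rw [dunkl, dunklY, mul_sub, outer_mul hc, mul_smul_comm, Finset.mul_sum, mul_one, one_mul]
    simp only [dunklTerm, outer_mul hc, one_mul]
  have hD : dunkl φ ψ Δ u c t i ∈ F := by
    refine sub_mem (hF1 _) (F.smul_mem (sum_mem fun k _ => ?_) _)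
    by_cases hk : k = i
    · rw [hk, dunklTerm_self]
      exact zero_mem _
    · exact hFdiff k i _ hk
  have hS : ∑ k, outer φ ψ (X i * Δ k i) (oddTrans t k i) ∈ F := by
    refine sum_mem fun k _ => ?_
    by_cases hk : k = i
    · rw [hk, oddTrans_self, outer_zero]
      exact zero_mem _
    · exact hFX i k i _ hk
  have hM : oddJM (twist φ ψ π t) i ∈ F := by
    refine sum_mem fun k hk => ?_
    rw [oddTrans_twist ht hc (Finset.mem_filter.mp hk).2.ne]
    exact hFperm _ _
  rw [zElem, hYD, smul_sub, smul_smul, inv_mul_cancel₀ hu, one_smul]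
  convert add_mem (sub_mem (F.smul_mem hD α) hS) hM using 1
  abel

end Dunkl

/-! ### A faithful module over the spin symmetric group algebra with Clifford operators -/

section Clifford

open scoped TensorProduct

theorem isSkew_twist {n : ℕ} {E R T : Type*} [Ring E] [Algebra ℂ E] [Ring R] [Algebra ℂ R] [Ring T]
    [Algebra ℂ T] {φ : E →ₐ[ℂ] T} {ψ : R →ₐ[ℂ] T} (hc : ∀ a b, Commute (φ a) (ψ b))
    {π : Perm (Fin n) →* E} {t : Fin (n - 1) → R} (ht : IsSpin t) {γ : Fin n → E}
    (hγ : ∀ i j, i ≠ j → γ i * γ j = -(γ j * γ i))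
    (hπ : ∀ i k, π (simpleSwap i) * γ k = -(γ (simpleSwap i k) * π (simpleSwap i))) :
    IsSkew (fun i => outer φ ψ (γ i) 1) (twist φ ψ π t) := by
  refine ⟨ht.twist hc, fun i j hij => ?_, fun i k => ?_⟩
  · simp only [outer_mul hc, hγ i j hij, neg_outer]
  · simp only [twist, outer_mul hc, hπ, neg_outer, one_mul, mul_one]

variable {n : ℕ}

/-- The quadratic form `∑ v_i ^ 2`. -/
def sumSq (n : ℕ) : QuadraticForm ℂ (Fin n → ℂ) :=
  QuadraticMap.weightedSumSquares ℂ fun _ => (1 : ℂ)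

theorem sumSq_apply (v : Fin n → ℂ) : sumSq n v = ∑ i, v i * v i := by
  simp [sumSq, QuadraticMap.weightedSumSquares_apply]

/-- The sign of a permutation as a complex number. -/
def csign (n : ℕ) : Perm (Fin n) →* ℂ :=
  ((Int.castRingHom ℂ : ℤ →* ℂ).comp (Units.coeHom ℤ)).comp Perm.sign

theorem csign_mul_self (σ : Perm (Fin n)) : csign n σ * csign n σ = 1 := by
  rcases Int.units_eq_one_or (Perm.sign σ) with h | h <;> simp [csign, h]

/-- The permutation of the coordinates by `σ`, multiplied by the sign of `σ`. -/
def signedPerm (σ : Perm (Fin n)) : QuadraticMap.Isometry (sumSq n) (sumSq n) where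
  toLinearMap := csign n σ • LinearMap.funLeft ℂ ℂ (σ⁻¹ : Perm (Fin n))
  map_app' v := by
    change sumSq n (csign n σ • (v ∘ (σ⁻¹ : Perm (Fin n)))) = sumSq n v
    rw [sumSq_apply, sumSq_apply, ← Equiv.sum_comp (σ⁻¹ : Perm (Fin n)) fun i => v i * v i]
    refine Finset.sum_congr rfl fun i _ => ?_
    simp only [Pi.smul_apply, Function.comp_apply, smul_eq_mul]
    rw [mul_mul_mul_comm, csign_mul_self, one_mul]

theorem signedPerm_apply (σ : Perm (Fin n)) (v : Fin n → ℂ) :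
    signedPerm σ v = csign n σ • (v ∘ (σ⁻¹ : Perm (Fin n))) := rfl

/-- The Clifford algebra of the form `∑ v_i ^ 2`. -/
abbrev Cliff (n : ℕ) : Type := CliffordAlgebra (sumSq n)

instance : Nontrivial (Cliff n) :=
  haveI : Invertible (2 : ℂ) := invertibleOfNonzero two_ne_zero
  inferInstance

/-- The symmetric group acts on the Clifford algebra by signed permutations of the generators. The
sign turns the relation `s_i c_k = c_{s_i k} s_i` into `s_i c_k = -c_{s_i k} s_i`. -/
def cliffPerm (n : ℕ) : Perm (Fin n) →* Module.End ℂ (Cliff n) where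
  toFun σ := (CliffordAlgebra.map (signedPerm σ)).toLinearMap
  map_one' := by
    have : signedPerm (1 : Perm (Fin n)) = QuadraticMap.Isometry.id _ :=
      QuadraticMap.Isometry.ext fun v => by simp [signedPerm_apply]
    rw [this, CliffordAlgebra.map_id]
    rfl
  map_mul' σ τ := by
    have : signedPerm (σ * τ) = (signedPerm σ).comp (signedPerm τ) :=
      QuadraticMap.Isometry.ext fun v => by
        simp only [QuadraticMap.Isometry.comp_apply, signedPerm_apply, map_mul, mul_smul]
        rfl
    rw [this, ← CliffordAlgebra.map_comp_map]
    rfl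

/-- The generators of the Clifford algebra. -/
def cliffGen (i : Fin n) : Cliff n := CliffordAlgebra.ι (sumSq n) (Pi.single i 1)

theorem cliffGen_mul_self (i : Fin n) : cliffGen i * cliffGen i = 1 := by
  rw [cliffGen, CliffordAlgebra.ι_sq_scalar, sumSq_apply]
  simp [Pi.single_apply]

theorem cliffGen_anticomm {i j : Fin n} (h : i ≠ j) :
    cliffGen i * cliffGen j = -(cliffGen j * cliffGen i) := by
  refine CliffordAlgebra.ι_mul_ι_comm_of_isOrtho ?_
  rw [QuadraticMap.isOrtho_def]
  simp only [sumSq_apply, ← Finset.sum_add_distrib]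
  refine Finset.sum_congr rfl fun k _ => ?_
  by_cases hk : k = i
  · simp [hk, h]
  · simp [Pi.single_apply, hk]

/-- Left multiplication by a generator of the Clifford algebra. -/
def cliffMul (i : Fin n) : Module.End ℂ (Cliff n) := LinearMap.mulLeft ℂ (cliffGen i)

theorem cliffMul_anticomm {i j : Fin n} (h : i ≠ j) :
    cliffMul i * cliffMul j = -(cliffMul j * cliffMul i) := by
  refine LinearMap.ext fun x => ?_
  simp only [cliffMul, Module.End.mul_apply, LinearMap.neg_apply, LinearMap.mulLeft_apply]
  rw [← mul_assoc, cliffGen_anticomm h, neg_mul, mul_assoc]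

theorem cliffMul_mul_self (i : Fin n) : cliffMul i * cliffMul i = 1 := by
  refine LinearMap.ext fun x => ?_
  simp only [cliffMul, Module.End.mul_apply, LinearMap.mulLeft_apply, Module.End.one_apply]
  rw [← mul_assoc, cliffGen_mul_self, one_mul]

theorem cliffPerm_mul_cliffMul (i : Fin (n - 1)) (k : Fin n) :
    cliffPerm n (simpleSwap i) * cliffMul k =
      -(cliffMul (simpleSwap i k) * cliffPerm n (simpleSwap i)) := by
  have hv : signedPerm (simpleSwap i) (Pi.single k 1) = -Pi.single (simpleSwap i k) 1 := by
    have hs : csign n (simpleSwap i) = -1 := by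
      simp [csign, simpleSwap, Perm.sign_swap (lo_ne_hi i)]
    rw [signedPerm_apply, hs, neg_one_smul]
    congr 1
    ext j
    simp only [Function.comp_apply, Pi.single_apply, Perm.inv_eq_iff_eq]
  refine LinearMap.ext fun x => ?_
  simp only [cliffMul, cliffPerm, Module.End.mul_apply, LinearMap.neg_apply,
    LinearMap.mulLeft_apply, MonoidHom.coe_mk, OneHom.coe_mk, AlgHom.toLinearMap_apply, map_mul]
  rw [cliffGen, CliffordAlgebra.map_apply_ι, hv, map_neg, neg_mul, cliffGen]

/-- Operators on a first tensor factor. -/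
def onLeft (M N : Type*) [AddCommGroup M] [Module ℂ M] [AddCommGroup N] [Module ℂ N] :
    Module.End ℂ M →ₐ[ℂ] Module.End ℂ (M ⊗[ℂ] N) := Module.End.rTensorAlgHom ℂ M N

/-- Operators on a second tensor factor. -/
def onRight (M N : Type*) [AddCommGroup M] [Module ℂ M] [AddCommGroup N] [Module ℂ N] :
    Module.End ℂ N →ₐ[ℂ] Module.End ℂ (M ⊗[ℂ] N) := Module.End.lTensorAlgHom ℂ N M

section

variable {M N : Type*} [AddCommGroup M] [Module ℂ M] [AddCommGroup N] [Module ℂ N]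

theorem onLeft_onRight_commute (f : Module.End ℂ M) (g : Module.End ℂ N) :
    Commute (onLeft M N f) (onRight M N g) :=
  show onLeft M N f * onRight M N g = onRight M N g * onLeft M N f from
  (LinearMap.rTensor_comp_lTensor M f g).trans (LinearMap.lTensor_comp_rTensor M f g).symm

theorem outer_tmul (f : Module.End ℂ M) (g : Module.End ℂ N) (x : M) (y : N) :
    outer (onLeft M N) (onRight M N) f g (x ⊗ₜ y) = f x ⊗ₜ g y := rfl

end

/-- The tensor product of the Clifford algebra and the spin symmetric group algebra. -/
abbrev SkewModule (n : ℕ) : Type := Cliff n ⊗[ℂ] SpinSym n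

/-- Left multiplication on the second factor by elements of the spin symmetric group algebra. -/
def spinMul (n : ℕ) : SpinSym n →ₐ[ℂ] Module.End ℂ (SkewModule n) :=
  (onRight (Cliff n) (SpinSym n)).comp (Algebra.lmul ℂ (SpinSym n))

theorem spinMul_commute (f : Module.End ℂ (Cliff n)) (x : SpinSym n) :
    Commute (onLeft (Cliff n) (SpinSym n) f) (spinMul n x) :=
  onLeft_onRight_commute _ _

/-- The action of `c_i` on `SkewModule n`. -/
def skewC (i : Fin n) : Module.End ℂ (SkewModule n) :=
  outer (onLeft (Cliff n) (SpinSym n)) (spinMul n) (cliffMul i) 1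

/-- The action of `t_i` on `SkewModule n`, which twists multiplication by `t_i`. -/
def skewT (i : Fin (n - 1)) : Module.End ℂ (SkewModule n) :=
  twist (onLeft (Cliff n) (SpinSym n)) (spinMul n) (cliffPerm n) SpinSym.t i

theorem isSkew_skewC_skewT (n : ℕ) : IsSkew (skewC (n := n)) skewT :=
  isSkew_twist spinMul_commute SpinSym.isSpin_t
    (fun _ _ => cliffMul_anticomm) cliffPerm_mul_cliffMul

theorem skewC_mul_self (i : Fin n) : skewC i * skewC i = 1 := by
  rw [skewC, outer_mul spinMul_commute, cliffMul_mul_self, one_mul,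
    outer_one_one]

theorem SpinSym.lift_skewT_one (x y : SpinSym n) :
    SpinSym.lift (isSkew_skewC_skewT n).spin x ((1 : Cliff n) ⊗ₜ y) = 1 ⊗ₜ (x * y) := by
  have hx : x ∈ Algebra.adjoin ℂ (Set.range (SpinSym.t (n := n))) := by
    rw [show (SpinSym.t (n := n)) = fun i => RingQuot.mkAlgHom ℂ _ (FreeAlgebra.ι ℂ i) from rfl,
      presented_adjoin]
    trivial
  induction hx using Algebra.adjoin_induction generalizing y with
  | mem x hx =>
    obtain ⟨i, rfl⟩ := hx
    rw [SpinSym.lift_t]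
    change cliffPerm n (simpleSwap i) 1 ⊗ₜ (SpinSym.t i * y) = _
    congr 1
    exact map_one (CliffordAlgebra.map (signedPerm (simpleSwap i)))
  | algebraMap r =>
    rw [AlgHom.commutes, Module.algebraMap_end_apply, Algebra.algebraMap_eq_smul_one,
      smul_mul_assoc, one_mul, TensorProduct.tmul_smul]
  | add a b _ _ ha hb =>
    rw [map_add, LinearMap.add_apply, ha, hb, add_mul, TensorProduct.tmul_add]
  | mul a b _ _ ha hb =>
    rw [map_mul, Module.End.mul_apply, hb, ha, mul_assoc]

/-- The spin symmetric group algebra acts faithfully. -/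
theorem SpinSym.eq_zero_of_lift_skewT {x : SpinSym n}
    (hx : SpinSym.lift (isSkew_skewC_skewT n).spin x = 0) : x = 0 := by
  have h := SpinSym.lift_skewT_one x 1
  rw [hx, LinearMap.zero_apply, mul_one] at h
  have hinj := Algebra.TensorProduct.includeRight_injective (R := ℂ) (A := Cliff n)
    (B := SpinSym n) (algebraMap ℂ (Cliff n)).injective
  exact hinj (by rw [map_zero]; exact h.symm)

end Clifford

/-! ### Leading terms in the Dunkl representation -/

section LeadingTerms

open scoped TensorProduct
open MvPolynomial

variable {n : ℕ} {V : Type*} [AddCommGroup V] [Module ℂ V]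

/-- The elements of `ℂ[x] ⊗ V` of degree less than `N` in the variables `x_i`. -/
def tensorBelow (n N : ℕ) (V : Type*) [AddCommGroup V] [Module ℂ V] :
    Submodule ℂ (MvPolynomial (Fin n) ℂ ⊗[ℂ] V) :=
  Submodule.span ℂ {x | ∃ f ∈ degBelow n N, ∃ v : V, f ⊗ₜ v = x}

theorem tmul_mem_tensorBelow {N : ℕ} {f : MvPolynomial (Fin n) ℂ} (hf : f ∈ degBelow n N) (v : V) :
    f ⊗ₜ v ∈ tensorBelow n N V :=
  Submodule.subset_span ⟨f, hf, v, rfl⟩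

theorem tensorBelow_mono {N N' : ℕ} (h : N ≤ N') : tensorBelow n N V ≤ tensorBelow n N' V :=
  Submodule.span_mono fun _ ⟨f, hf, v, hv⟩ => ⟨f, degBelow_mono h hf, v, hv⟩

/-- The coefficient of a monomial, with values in `V`. -/
def tensorCoeff (V : Type*) [AddCommGroup V] [Module ℂ V] (m : Fin n →₀ ℕ) :
    MvPolynomial (Fin n) ℂ ⊗[ℂ] V →ₗ[ℂ] V :=
  (TensorProduct.lid ℂ V).toLinearMap ∘ₗ LinearMap.rTensor V (lcoeff ℂ m)

@[simp]
theorem tensorCoeff_tmul (m : Fin n →₀ ℕ) (f : MvPolynomial (Fin n) ℂ) (v : V) :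
    tensorCoeff V m (f ⊗ₜ v) = coeff m f • v := by
  simp [tensorCoeff]

theorem tensorCoeff_eq_zero {N : ℕ} {m : Fin n →₀ ℕ} (hm : N ≤ m.degree)
    {x : MvPolynomial (Fin n) ℂ ⊗[ℂ] V} (hx : x ∈ tensorBelow n N V) : tensorCoeff V m x = 0 := by
  have hle : tensorBelow n N V ≤ LinearMap.ker (tensorCoeff V m) := by
    refine Submodule.span_le.mpr ?_
    rintro _ ⟨f, hf, v, rfl⟩
    simp [hf m hm]
  exact hle hx

/-- The operator on `ℂ[x] ⊗ V` given by operators on the two factors. -/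
abbrev tensorOp (f : Module.End ℂ (MvPolynomial (Fin n) ℂ)) (g : Module.End ℂ V) :
    Module.End ℂ (MvPolynomial (Fin n) ℂ ⊗[ℂ] V) :=
  outer (onLeft (MvPolynomial (Fin n) ℂ) V) (onRight (MvPolynomial (Fin n) ℂ) V) f g

theorem tensorOp_mem_tensorBelow {f : Module.End ℂ (MvPolynomial (Fin n) ℂ)} {N N' : ℕ}
    (hf : ∀ p ∈ degBelow n N, f p ∈ degBelow n N') (g : Module.End ℂ V)
    {x : MvPolynomial (Fin n) ℂ ⊗[ℂ] V} (hx : x ∈ tensorBelow n N V) :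
    tensorOp f g x ∈ tensorBelow n N' V := by
  have hle : tensorBelow n N V ≤ (tensorBelow n N' V).comap (tensorOp f g) := by
    refine Submodule.span_le.mpr ?_
    rintro _ ⟨p, hp, v, rfl⟩
    exact tmul_mem_tensorBelow (hf p hp) (g v)
  exact hle hx

/-- The operators that do not raise the degree in the variables `x_i`. -/
def filtered (n : ℕ) (V : Type*) [AddCommGroup V] [Module ℂ V] :
    Subalgebra ℂ (Module.End ℂ (MvPolynomial (Fin n) ℂ ⊗[ℂ] V)) where
  carrier := {T | ∀ N, ∀ x ∈ tensorBelow n N V, T x ∈ tensorBelow n N V}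
  mul_mem' := fun ha hb N x hx => ha N _ (hb N x hx)
  add_mem' := fun ha hb N x hx => add_mem (ha N x hx) (hb N x hx)
  algebraMap_mem' := fun r N x hx => by
    rw [Module.algebraMap_end_apply]
    exact Submodule.smul_mem _ r hx

theorem tensorOp_mem_filtered {f : Module.End ℂ (MvPolynomial (Fin n) ℂ)}
    (hf : ∀ N, ∀ p ∈ degBelow n N, f p ∈ degBelow n N) (g : Module.End ℂ V) :
    tensorOp f g ∈ filtered n V :=
  fun N _ hx => tensorOp_mem_tensorBelow (hf N) g hx

variable {c : Fin n → Module.End ℂ V} {t : Fin (n - 1) → Module.End ℂ V}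

/-- The action of `ξ_i` on `ℂ[x] ⊗ V`. -/
def tensorXi (u : ℂ) (c : Fin n → Module.End ℂ V) (t : Fin (n - 1) → Module.End ℂ V) (i : Fin n) :
    Module.End ℂ (MvPolynomial (Fin n) ℂ ⊗[ℂ] V) :=
  dunkl (onLeft _ V) (onRight _ V) divDiff u c t i

/-- The action of `y_i` on `ℂ[x] ⊗ V`. -/
def tensorY (V : Type*) [AddCommGroup V] [Module ℂ V] (i : Fin n) :
    Module.End ℂ (MvPolynomial (Fin n) ℂ ⊗[ℂ] V) :=
  dunklY (onLeft _ V) (onRight _ V) mulX i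

/-- The action of `t_i` on `ℂ[x] ⊗ V`. -/
def tensorT (t : Fin (n - 1) → Module.End ℂ V) (i : Fin (n - 1)) :
    Module.End ℂ (MvPolynomial (Fin n) ℂ ⊗[ℂ] V) :=
  twist (onLeft _ V) (onRight _ V) (permPoly n) t i

theorem isDaha_tensor (h : IsSkew c t) (u : ℂ) :
    IsDaha u (tensorXi u c t) (tensorY V) (tensorT t) :=
  isDaha_dunkl isDivDiff_divDiff onLeft_onRight_commute h u

/-- The Dunkl representation on `ℂ[x] ⊗ V`. -/
def dunklRep (h : IsSkew c t) (u : ℂ) :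
    SpinDaha u n →ₐ[ℂ] Module.End ℂ (MvPolynomial (Fin n) ℂ ⊗[ℂ] V) :=
  (isDaha_tensor h u).lift

theorem dunklRep_t (h : IsSkew c t) (u : ℂ) (i : Fin (n - 1)) :
    dunklRep h u (SpinDaha.t u i) = tensorT t i := (isDaha_tensor h u).lift_t i

/-- The action of `α ξ_i + 𝔷_i` has the leading term `u⁻¹ x_i ⊗ c_i`. -/
theorem dunklRep_b_sub_mem (h : IsSkew c t) (u α : ℂ) (hu : u ≠ 0) (i : Fin n) :
    dunklRep h u (α • SpinDaha.xi u i + zElem u (SpinDaha.xi u) (SpinDaha.y u) (SpinDaha.t u) i) -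
      u⁻¹ • tensorOp (mulX i) (c i) ∈ filtered n V := by
  have hmap : dunklRep h u
      (α • SpinDaha.xi u i + zElem u (SpinDaha.xi u) (SpinDaha.y u) (SpinDaha.t u) i) =
      α • tensorXi u c t i + zElem u (tensorXi u c t) (tensorY V) (tensorT t) i :=
    (isDaha_tensor h u).lift_zElem α i
  rw [hmap]
  exact dunkl_leadingTerm (F := filtered n V) onLeft_onRight_commute h.spin hu α
    (fun r => tensorOp_mem_filtered (fun N p hp => hp) r)
    (fun k j r hkj => tensorOp_mem_filtered (fun N p hp => divDiff_mem_degBelow hkj hp) r)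
    (fun i k j r hkj => tensorOp_mem_filtered (fun N p hp => divDiff_mulX_mem_degBelow hkj i hp) r)
    (fun σ r => tensorOp_mem_filtered (fun N p hp => rename_mem_degBelow σ hp) r) i

/-- The leading term of a product of operators with leading terms `u⁻¹ x_i ⊗ c_i`. -/
theorem prod_sub_mem_tensorBelow {w : ℂ} {B : Fin n → Module.End ℂ (MvPolynomial (Fin n) ℂ ⊗[ℂ] V)}
    (hB : ∀ i, B i - w • tensorOp (mulX i) (c i) ∈ filtered n V) (l : List (Fin n)) (v : V) :
    (l.map X).prod ∈ degBelow n (l.length + 1) ∧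
    (l.map B).prod (1 ⊗ₜ v) -
      w ^ l.length • ((l.map X).prod ⊗ₜ (l.map c).prod v) ∈ tensorBelow n l.length V := by
  induction l with
  | nil =>
    refine ⟨?_, by simp⟩
    simp [mem_degBelow_iff]
  | cons i l ih =>
    obtain ⟨hX, hl⟩ := ih
    simp only [List.map_cons, List.prod_cons, List.length_cons, Module.End.mul_apply]
    refine ⟨X_mul_mem_degBelow i hX, ?_⟩
    set x := (l.map B).prod (1 ⊗ₜ v)
    set p : MvPolynomial (Fin n) ℂ := (l.map X).prod
    set v' := (l.map c).prod v
    have hx : x ∈ tensorBelow n (l.length + 1) V := by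
      have := add_mem (tensorBelow_mono (Nat.le_succ _) hl)
        (Submodule.smul_mem _ (w ^ l.length) (tmul_mem_tensorBelow hX v'))
      rwa [sub_add_cancel] at this
    have h1 := hB i _ x hx
    have h2 := Submodule.smul_mem _ w
      (tensorOp_mem_tensorBelow (fun q hq => X_mul_mem_degBelow i hq) (c i) hl :
        tensorOp (mulX i) (c i) _ ∈ _)
    have h3 : tensorOp (mulX i) (c i) (p ⊗ₜ v') = (X i * p) ⊗ₜ c i v' := outer_tmul _ _ _ _
    rw [LinearMap.sub_apply, LinearMap.smul_apply] at h1
    rw [map_sub, map_smul, h3] at h2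
    have h4 := add_mem h1 h2
    convert h4 using 1
    rw [smul_sub, smul_smul, pow_succ']
    abel

theorem dunklRep_ofSpinSym (h : IsSkew c t) (u : ℂ) (x : SpinSym n) (v : V) :
    dunklRep h u (SpinDaha.ofSpinSym u n x) (1 ⊗ₜ v) = 1 ⊗ₜ SpinSym.lift h.spin x v := by
  have hx : x ∈ Algebra.adjoin ℂ (Set.range (SpinSym.t (n := n))) := by
    rw [show (SpinSym.t (n := n)) = fun i => RingQuot.mkAlgHom ℂ _ (FreeAlgebra.ι ℂ i) from rfl,
      presented_adjoin]
    trivial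
  induction hx using Algebra.adjoin_induction generalizing v with
  | mem x hx =>
    obtain ⟨i, rfl⟩ := hx
    rw [SpinDaha.ofSpinSym_t, SpinSym.lift_t, dunklRep_t, tensorT, twist, outer_tmul,
      permPoly_apply, map_one]
  | algebraMap r =>
    rw [AlgHom.commutes, AlgHom.commutes, AlgHom.commutes, Module.algebraMap_end_apply,
      Module.algebraMap_end_apply, TensorProduct.tmul_smul]
  | add a b _ _ ha hb =>
    rw [map_add, map_add, map_add, LinearMap.add_apply, LinearMap.add_apply, ha, hb,
      TensorProduct.tmul_add]
  | mul a b _ _ ha hb =>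
    rw [map_mul, map_mul, map_mul, Module.End.mul_apply, Module.End.mul_apply, hb, ha]

end LeadingTerms

/-! ### Spanning the affine Hecke algebra -/

section Spanning

variable {n : ℕ}

/-- The products of a list of anticommuting elements depend on its order only up to a sign. -/
theorem prod_perm_anticomm {ι A : Type*} [Ring A] {b : ι → A}
    (hb : ∀ i j, i ≠ j → b i * b j = -(b j * b i)) {l l' : List ι} (h : l.Perm l') :
    (l.map b).prod = (l'.map b).prod ∨ (l.map b).prod = -(l'.map b).prod := by
  induction h with
  | nil => simp
  | cons i _ ih =>
    simp only [List.map_cons, List.prod_cons]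
    rcases ih with h | h <;> simp [h]
  | swap i j l =>
    simp only [List.map_cons, List.prod_cons, ← mul_assoc]
    by_cases hij : i = j
    · simp [hij]
    · right
      rw [hb j i (Ne.symm hij), neg_mul]
  | trans _ _ h1 h2 =>
    rcases h1 with h1 | h1 <;> rcases h2 with h2 | h2 <;> simp [h1, h2]

theorem prod_perm_mul {ι A : Type*} [Ring A] {b : ι → A}
    (hb : ∀ i j, i ≠ j → b i * b j = -(b j * b i)) {l l' : List ι} (h : l.Perm l') (y : A) :
    (l.map b).prod * y = (l'.map b).prod * y ∨ (l.map b).prod * y = -((l'.map b).prod * y) := by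
  rcases prod_perm_anticomm hb h with h | h <;> simp [h]

/-- A word in which each index `i` occurs `m i` times, the order being chosen arbitrarily for
each `m`. -/
def word (m : Fin n →₀ ℕ) : List (Fin n) := (Finsupp.toMultiset m).toList

theorem perm_word (l : List (Fin n)) : ∃ m : Fin n →₀ ℕ, l.Perm (word m) := by
  refine ⟨Multiset.toFinsupp (l : Multiset (Fin n)), ?_⟩
  rw [word, Multiset.toFinsupp_toMultiset, ← Multiset.coe_eq_coe, Multiset.coe_toList]

theorem length_word (m : Fin n →₀ ℕ) : (word m).length = m.degree := by
  rw [word, Multiset.length_toList, Finsupp.card_toMultiset]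
  rfl

theorem prod_map_X_word (m : Fin n →₀ ℕ) :
    ((word m).map (MvPolynomial.X (R := ℂ))).prod = MvPolynomial.monomial m 1 := by
  rw [word, ← Multiset.prod_coe, ← Multiset.map_coe, Multiset.coe_toList, Finsupp.toMultiset_map,
    Finsupp.prod_toMultiset, MvPolynomial.monomial_eq, MvPolynomial.C_1, one_mul,
    Finsupp.prod_mapDomain_index (fun _ => pow_zero _) (fun _ _ _ => pow_add _ _ _)]

/-- The canonical homomorphism from the spin symmetric group algebra. -/
def SpinAffine.ofSpinSym (n : ℕ) : SpinSym n →ₐ[ℂ] SpinAffine n :=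
  SpinSym.lift (SpinAffine.isAffine n).spin

/-- The linear combination of monomials in the `b_i`, one for each exponent, with
coefficients, on the right, in the spin symmetric group algebra. -/
def SpinAffine.expand (n : ℕ) : ((Fin n →₀ ℕ) →₀ SpinSym n) →ₗ[ℂ] SpinAffine n :=
  Finsupp.lsum ℂ fun m => LinearMap.mulLeft ℂ ((word m).map SpinAffine.b).prod ∘ₗ
    (SpinAffine.ofSpinSym n).toLinearMap

theorem SpinAffine.expand_apply (g : (Fin n →₀ ℕ) →₀ SpinSym n) :
    SpinAffine.expand n g =
      ∑ m ∈ g.support, ((word m).map SpinAffine.b).prod * SpinAffine.ofSpinSym n (g m) := rfl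

theorem SpinAffine.prod_mul_mem_range (l : List (Fin n)) (x : SpinSym n) :
    (l.map SpinAffine.b).prod * SpinAffine.ofSpinSym n x ∈
      LinearMap.range (SpinAffine.expand n) := by
  obtain ⟨m, hm⟩ := perm_word l
  have hmem : ((word m).map SpinAffine.b).prod * SpinAffine.ofSpinSym n x ∈
      LinearMap.range (SpinAffine.expand n) :=
    ⟨Finsupp.single m x, by simp [SpinAffine.expand]⟩
  rcases prod_perm_mul (SpinAffine.isAffine n).b_b hm (SpinAffine.ofSpinSym n x) with h | h
  · rwa [h]
  · rw [h]
    exact neg_mem hmem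

/-- Moving `t_j` past `b_i` costs at most a term without `t_j` and `b_i`. -/
theorem IsAffine.t_b_mul {A : Type*} [Ring A] {b : Fin n → A} {t : Fin (n - 1) → A}
    (h : IsAffine b t) (j : Fin (n - 1)) (i : Fin n) (y : A) :
    t j * (b i * y) = -(b (simpleSwap j i) * (t j * y)) ∨
      t j * (b i * y) = -(b (simpleSwap j i) * (t j * y)) + y := by
  have h1 : t j * b (lo j) = -(b (hi j) * t j) + 1 := by rw [h.b_t]; abel
  by_cases hl : i = lo j
  · right
    rw [hl, simpleSwap_lo, ← mul_assoc, h1]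
    noncomm_ring
  by_cases hh : i = hi j
  · right
    have h2 : t j * (b (hi j) * t j) * t j = t j * (-(t j * b (lo j)) + 1) * t j := by rw [h.b_t]
    have hs := h.spin.mul_self j
    rw [mul_assoc, mul_assoc, hs, mul_one, mul_add, mul_neg, ← mul_assoc, hs, one_mul, mul_one,
      add_mul, hs, neg_mul] at h2
    rw [hh, simpleSwap_hi, ← mul_assoc, h2]
    noncomm_ring
  · left
    rw [simpleSwap_far hl hh, ← mul_assoc, h.t_b_far j i hl hh]
    noncomm_ring

theorem SpinAffine.b_mul_mem_range (i : Fin n) {x : SpinAffine n}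
    (hx : x ∈ LinearMap.range (SpinAffine.expand n)) :
    SpinAffine.b i * x ∈ LinearMap.range (SpinAffine.expand n) := by
  obtain ⟨g, rfl⟩ := hx
  rw [SpinAffine.expand_apply, Finset.mul_sum]
  refine sum_mem fun m _ => ?_
  have := SpinAffine.prod_mul_mem_range (i :: word m) (g m)
  rwa [List.map_cons, List.prod_cons, mul_assoc] at this

theorem SpinAffine.t_mul_mem_range (j : Fin (n - 1)) {x : SpinAffine n}
    (hx : x ∈ LinearMap.range (SpinAffine.expand n)) :
    SpinAffine.t j * x ∈ LinearMap.range (SpinAffine.expand n) := by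
  have key : ∀ (l : List (Fin n)) (y : SpinSym n),
      SpinAffine.t j * ((l.map SpinAffine.b).prod * SpinAffine.ofSpinSym n y) ∈
        LinearMap.range (SpinAffine.expand n) := by
    intro l y
    induction l with
    | nil =>
      have := SpinAffine.prod_mul_mem_range [] (SpinSym.t j * y)
      have ht : SpinAffine.ofSpinSym n (SpinSym.t j) = SpinAffine.t j := SpinSym.lift_t _ j
      rw [map_mul, ht, List.map_nil, List.prod_nil, one_mul] at this
      rwa [List.map_nil, List.prod_nil, one_mul]
    | cons i l ih =>
      have hP := SpinAffine.prod_mul_mem_range l y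
      rw [List.map_cons, List.prod_cons, mul_assoc]
      have hn := neg_mem (SpinAffine.b_mul_mem_range (simpleSwap j i) ih)
      rcases (SpinAffine.isAffine n).t_b_mul j i ((l.map SpinAffine.b).prod *
        SpinAffine.ofSpinSym n y) with h | h
      · rw [h]
        exact hn
      · rw [h]
        exact add_mem hn hP
  obtain ⟨g, rfl⟩ := hx
  rw [SpinAffine.expand_apply, Finset.mul_sum]
  exact sum_mem fun m _ => key _ _

theorem SpinAffine.adjoin_generators (n : ℕ) :
    Algebra.adjoin ℂ (Set.range (SpinAffine.b (n := n)) ∪ Set.range SpinAffine.t) = ⊤ := by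
  rw [eq_top_iff, ← presented_adjoin (ARel n)]
  refine Algebra.adjoin_mono ?_
  rintro _ ⟨i | i, rfl⟩
  exacts [Or.inl ⟨i, rfl⟩, Or.inr ⟨i, rfl⟩]

/-- The monomials in the `b_i`, one for each exponent, span the affine Hecke algebra over the
spin symmetric group algebra. -/
theorem SpinAffine.expand_surjective (n : ℕ) : Function.Surjective (SpinAffine.expand n) := by
  have h1 : (1 : SpinAffine n) ∈ LinearMap.range (SpinAffine.expand n) := by
    have := SpinAffine.prod_mul_mem_range ([] : List (Fin n)) 1
    rwa [map_one, mul_one] at this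
  have key : ∀ x : SpinAffine n, ∀ y ∈ LinearMap.range (SpinAffine.expand n),
      x * y ∈ LinearMap.range (SpinAffine.expand n) := by
    intro x
    have hx : x ∈ Algebra.adjoin ℂ (Set.range (SpinAffine.b (n := n)) ∪ Set.range SpinAffine.t) :=
      SpinAffine.adjoin_generators n ▸ Algebra.mem_top
    induction hx using Algebra.adjoin_induction with
    | mem x hx =>
      rcases hx with ⟨i, rfl⟩ | ⟨i, rfl⟩
      · exact fun y hy => SpinAffine.b_mul_mem_range i hy
      · exact fun y hy => SpinAffine.t_mul_mem_range i hy
    | algebraMap r =>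
      intro y hy
      rw [← Algebra.smul_def]
      exact Submodule.smul_mem _ r hy
    | add a b _ _ ha hb =>
      intro y hy
      rw [add_mul]
      exact add_mem (ha y hy) (hb y hy)
    | mul a b _ _ ha hb =>
      intro y hy
      rw [mul_assoc]
      exact ha _ (hb y hy)
  intro x
  have := key x 1 h1
  rwa [mul_one] at this

end Spanning

/-! ### The isomorphism -/

section Isomorphism

open scoped TensorProduct

variable {n : ℕ}

theorem z_eq_zElem (u : ℂ) (i : Fin n) :
    SpinDaha.z u i = zElem u (SpinDaha.xi u) (SpinDaha.y u) (SpinDaha.t u) i := by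
  rw [SpinDaha.z, zElem, map_oddJM]
  congr 3
  exact funext (SpinDaha.ofSpinSym_t u)

/-- The homomorphism from the affine Hecke algebra to the double affine Hecke algebra with
`b_i ↦ α ξ_i + 𝔷_i` and `t_i ↦ t_i`. -/
def affineHom (n : ℕ) {u : ℂ} (hu : u ≠ 0) (α : ℂ) : SpinAffine n →ₐ[ℂ] SpinDaha u n :=
  ((SpinDaha.isDaha u n).isAffine hu α).lift

variable {u : ℂ} (hu : u ≠ 0) (α : ℂ)

theorem affineHom_b (i : Fin n) : affineHom n hu α (SpinAffine.b i) =
    α • SpinDaha.xi u i + zElem u (SpinDaha.xi u) (SpinDaha.y u) (SpinDaha.t u) i :=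
  IsAffine.lift_b _ i

theorem affineHom_t (i : Fin (n - 1)) : affineHom n hu α (SpinAffine.t i) = SpinDaha.t u i :=
  IsAffine.lift_t _ i

theorem affineHom_ofSpinSym (x : SpinSym n) :
    affineHom n hu α (SpinAffine.ofSpinSym n x) = SpinDaha.ofSpinSym u n x := by
  have h : (affineHom n hu α).comp (SpinAffine.ofSpinSym n) = SpinDaha.ofSpinSym u n := by
    refine presented_hom_ext fun i => ?_
    change affineHom n hu α (SpinAffine.ofSpinSym n (SpinSym.t i)) =
      SpinDaha.ofSpinSym u n (SpinSym.t i)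
    rw [SpinAffine.ofSpinSym, SpinSym.lift_t, affineHom_t, SpinDaha.ofSpinSym_t]
  exact congrArg (fun f => f x) h

theorem affineHom_range : (affineHom n hu α).range = SpinDaha.affineSubalgebra u α n := by
  refine le_antisymm ?_ (Algebra.adjoin_le ?_)
  · rw [← Algebra.map_top, ← SpinAffine.adjoin_generators, AlgHom.map_adjoin]
    refine Algebra.adjoin_mono ?_
    rintro _ ⟨_, ⟨i, rfl⟩ | ⟨i, rfl⟩, rfl⟩
    · exact Or.inl ⟨i, (congrArg (α • SpinDaha.xi u i + ·) (z_eq_zElem u i)).trans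
        (affineHom_b hu α i).symm⟩
    · exact Or.inr ⟨SpinSym.t i, by
        rw [SpinDaha.ofSpinSym_t]; exact (affineHom_t hu α i).symm⟩
  · rintro _ (⟨i, rfl⟩ | ⟨x, rfl⟩)
    · exact ⟨SpinAffine.b i, (affineHom_b hu α i).trans
        (congrArg (α • SpinDaha.xi u i + ·) (z_eq_zElem u i)).symm⟩
    · exact ⟨SpinAffine.ofSpinSym n x, affineHom_ofSpinSym hu α x⟩

/-- A product of the operators `c_i` is injective. -/
theorem prod_skewC_injective (l : List (Fin n)) {v : SkewModule n}
    (h : (l.map skewC).prod v = 0) : v = 0 := by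
  induction l with
  | nil => simpa using h
  | cons i l ih =>
    refine ih ?_
    rw [List.map_cons, List.prod_cons, Module.End.mul_apply] at h
    have h2 := congrArg (skewC i) h
    rwa [← Module.End.mul_apply, skewC_mul_self, map_zero, Module.End.one_apply] at h2

/-- A nonzero combination of monomials is detected by its coefficient at a monomial of the highest
degree. -/
theorem affineHom_injective : Function.Injective (affineHom n hu α) := by
  rw [injective_iff_map_eq_zero]
  intro x hx
  obtain ⟨g, rfl⟩ := SpinAffine.expand_surjective n x
  by_contra hne
  have hg : g.support.Nonempty := by
    rw [Finset.nonempty_iff_ne_empty, Ne, Finsupp.support_eq_empty]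
    rintro rfl
    exact hne (map_zero _)
  obtain ⟨m, hm, hmax⟩ := Finset.exists_max_image g.support Finsupp.degree hg
  have h := isSkew_skewC_skewT n
  refine Finsupp.mem_support_iff.mp hm (SpinSym.eq_zero_of_lift_skewT (LinearMap.ext fun v => ?_))
  refine prod_skewC_injective (word m) ?_
  set B := fun i => dunklRep h u (affineHom n hu α (SpinAffine.b i)) with hBdef
  have hB : ∀ i, B i - u⁻¹ • tensorOp (mulX i) (skewC i) ∈ filtered n (SkewModule n) := fun i => by
    rw [hBdef]
    simp only [affineHom_b]
    exact dunklRep_b_sub_mem h u α hu i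
  -- the coefficient of the monomial `m` in the image of `1 ⊗ v`
  have hsum : tensorCoeff (SkewModule n) m
      (dunklRep h u (affineHom n hu α (SpinAffine.expand n g)) (1 ⊗ₜ v)) = 0 := by
    rw [hx, map_zero, LinearMap.zero_apply, map_zero]
  rw [SpinAffine.expand_apply, map_sum, map_sum, LinearMap.sum_apply, map_sum] at hsum
  have hterm : ∀ k ∈ g.support, tensorCoeff (SkewModule n) m
      (dunklRep h u (affineHom n hu α (((word k).map SpinAffine.b).prod *
        SpinAffine.ofSpinSym n (g k))) (1 ⊗ₜ v)) =
      (u⁻¹ ^ k.degree * MvPolynomial.coeff m (MvPolynomial.monomial k 1)) •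
        ((word k).map skewC).prod (SpinSym.lift h.spin (g k) v) := by
    intro k hk
    have hlead := (prod_sub_mem_tensorBelow hB (word k) (SpinSym.lift h.spin (g k) v)).2
    have hz := tensorCoeff_eq_zero (m := m) (by rw [length_word]; exact hmax k hk) hlead
    rw [map_sub, map_smul, tensorCoeff_tmul, prod_map_X_word, length_word, sub_eq_zero, smul_smul]
      at hz
    rw [← hz, map_mul, map_mul, Module.End.mul_apply, affineHom_ofSpinSym, dunklRep_ofSpinSym,
      map_list_prod, map_list_prod, List.map_map, List.map_map]
    rfl
  rw [Finset.sum_congr rfl hterm, Finset.sum_eq_single_of_mem m hm] at hsum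
  · rw [MvPolynomial.coeff_monomial, if_pos rfl, mul_one] at hsum
    exact (smul_eq_zero.mp hsum).resolve_left (pow_ne_zero _ (inv_ne_zero hu))
  · intro k _ hkm
    rw [MvPolynomial.coeff_monomial, if_neg hkm, mul_zero, zero_smul]

end Isomorphism

end SpinHecke

end

theorem mainTheorem6 (n : ℕ) (u : ℂ) (hu : u ≠ 0) (α : ℂ) :
    ∃ e : SpinHecke.SpinAffine n ≃ₐ[ℂ] SpinHecke.SpinDaha.affineSubalgebra u α n,
      (∀ i : Fin n, (e (SpinHecke.SpinAffine.b i) : SpinHecke.SpinDaha u n) =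
        α • SpinHecke.SpinDaha.xi u i + SpinHecke.SpinDaha.z u i) ∧
      (∀ i : Fin (n - 1), (e (SpinHecke.SpinAffine.t i) : SpinHecke.SpinDaha u n) =
        SpinHecke.SpinDaha.t u i) := by
  refine ⟨(AlgEquiv.ofInjective _ (SpinHecke.affineHom_injective hu α)).trans
    (Subalgebra.equivOfEq _ _ (SpinHecke.affineHom_range hu α)), fun i => ?_, fun i => ?_⟩
  · rw [SpinHecke.z_eq_zElem]
    exact SpinHecke.affineHom_b hu α i
  · exact SpinHecke.affineHom_t hu α i
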